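/- **Setting.** Let $k,n\ge 0$ be integers with $n\ge 2k$, and let $\lambda=[\lambda_1,\lambda_2,\dots]$ be a partition of $n$ such that $\lambda^*=[\lambda_2,\lambda_3,\dots]$ satisfies $|\lambda^*|\le k$. *Diagrams.* A diagram $d$ is a set partition of $\{1,\dots,k\}\cup\{1',\dots,k'\}$ (top and bottom vertices). The generators of the partition algebra are the following diagrams; each has, besides the blocks listed, the blocks $\{x,x'\}$ for all other $x$. For $1\le i\le k-1$, $\mathfrak s_i$ has the blocks $\{i,(i+1)'\}$, $\{i+1,i'\}$ and $\mathfrak b_i$ has the block $\{i,i+1,i',(i+1)'\}$. For $1\le i\le k$, $\mathfrak p_i$ has the blocks $\{i\}$, $\{i'\}$. For a set partition $\pi$ of $\{1,\dots,k\}$, the concatenation $d\circ\pi$ is obtained by placing $\pi$ below $d$, joining $x'$ and $y'$ whenever $x,y$ lie in one block of $\pi$; $\mathsf{top}(d\circ\pi)$ is the induced set partition of the top vertices. *Tableaux.* A set-partition tableau $\mathsf T$ of shape $\lambda$ and content $\pi$, where $\pi$ is a set partition of $\{1,\dots,k\}$ into $t$ blocks with $|\lambda^*|\le t\le n$, is a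 bijective filling of the boxes of the skew shape $\lambda/[n-t]$ with the blocks of $\pi$. Blocks in the first row are non-propagating, the blocks below it are propagating. Blocks are ordered by their maximal entries. Let $\overline{\mathcal{SPT}}(\lambda,k)$ be the set of these tableaux whose first row increases from left to right, and $\mathcal{SSPT}(\lambda,k)$ the set of those that are standard, that is, increase along all rows and columns. *Module.* In the complex vector space with basis $[\mathsf T]$, $\mathsf T\in\overline{\mathcal{SPT}}(\lambda,k)$, put $$\mathsf N_{\mathsf T}=\sum_{\gamma}\sum_{\rho}\operatorname{sign}(\gamma)\,[\mathsf T\circ(\gamma\rho)],$$ where $\gamma$ (resp. $\rho$) runs over the permutations of the boxes of $\lambda^*$ that preserve each column (resp. row), and $\mathsf T\circ g$ has the entry of $\mathsf T$ in box $g(c)$ placed in box $c$ (with the first row unchanged). Let $\mathsf P^\lambda_k$ be the span of all $\mathsf N_{\mathsf T}$. A diagram $d$ acts on $\mathsf P_k^\lambda$ by $$d\cdot\mathsf N_{\mathsf T}=n^{\ell(d,\mathsf T)}\,\mathsf N_{d(\mathsf T)}\ \text{ if } d(\mathsf T)\neq 0,\qquad d\cdot\mathsf N_{\mathsf T}=0\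 \text{ if } d(\mathsf T)=0 .$$ Here, for $\mathsf T$ of content $\pi$, $\ell(d,\mathsf T)$ is the number of connected components of $d\circ\pi$ without top vertices, and $d(\mathsf T)\in\overline{\mathcal{SPT}}(\lambda,k)$ has content $\mathsf{top}(d\circ\pi)$: each propagating block of $\mathsf T$ is replaced by the block of $\mathsf{top}(d\circ\pi)$ to which it is connected, and the remaining blocks are placed in increasing order in the first row. If two propagating blocks become connected, or a propagating block is connected to no top vertex, then $d(\mathsf T)=0$. **Theorem.** The vectors $\mathsf N_{\mathsf T}$, $\mathsf T\in\mathcal{SSPT}(\lambda,k)$, form a basis of $\mathsf P_k^\lambda$ (the natural basis), and for each $\mathsf T\in\mathcal{SSPT}(\lambda,k)$: (a) for $1\le i\le k-1$, $\mathfrak s_i\cdot\mathsf N_{\mathsf T}=\mathsf N_{\mathfrak s_i(\mathsf T)}$, where $\mathfrak s_i(\mathsf T)\in\overline{\mathcal{SPT}}(\lambda,k)$ is obtained from $\mathsf T$ by swapping $i$ and $i+1$ and standardizing (sorting) the first row. (b) for $1\le i\le k$, $$\mathfrak p_i\cdot\mathsf N_{\mathsf T}=\begin{cases} n\,\mathsf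 N_{\mathsf T}&\text{if }\{i\}\text{ is a non-propagating block of }\mathsf T,\\ 0&\text{if }\{i\}\text{ is a propagating block of }\mathsf T,\\ \mathsf N_{\mathfrak p_i(\mathsf T)}&\text{otherwise,}\end{cases}$$ where $\mathfrak p_i(\mathsf T)\in\overline{\mathcal{SPT}}(\lambda,k)$ is obtained from $\mathsf T$ by removing $i$ from its block, placing the block $\{i\}$ into the first row, and standardizing the first row. (c) for $1\le i\le k-1$, $$\mathfrak b_i\cdot\mathsf N_{\mathsf T}=\begin{cases} \mathsf N_{\mathsf T}&\text{if } i \text{ and } i+1\text{ are in the same block of }\mathsf T,\\ 0&\text{if } i\text{ and } i+1\text{ are in different propagating blocks of }\mathsf T,\\ \mathsf N_{\mathfrak b_i(\mathsf T)}&\text{otherwise,}\end{cases}$$ where $\mathfrak b_i(\mathsf T)\in\overline{\mathcal{SPT}}(\lambda,k)$ is obtained from $\mathsf T$ by joining the blocks of $i$ and $i+1$ and standardizing the first row; the resulting block takes the place of the propagating one if one of the two blocks is propagating, and is non-propagating otherwise. If $\mathsf S$ is one of the tableaux $\mathfrak s_i(\mathsf T)$, $\mathfrak p_i(\mathsf T)$,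 $\mathfrak b_i(\mathsf T)$ above, then $\mathsf N_{\mathsf S}$ is an integer linear combination of natural basis vectors that is obtained from the Garnir relations: there are integers $c_{\mathsf U}$ with $\mathsf N_{\mathsf S}=\sum_{\mathsf U}c_{\mathsf U}\mathsf N_{\mathsf U}$ (sum over $\mathsf U\in\mathcal{SSPT}(\lambda,k)$) such that the formal difference $[\mathsf S]-\sum_{\mathsf U}c_{\mathsf U}[\mathsf U]$ lies in the $\mathbb Z$-span of all elements $[\mathsf T'\circ\gamma]-\operatorname{sign}(\gamma)[\mathsf T']$, with $\gamma$ a permutation of the boxes of $\lambda^*$ preserving each column, and $\sum_g\operatorname{sign}(g)[\mathsf T'\circ g]$. In the latter, one fixes a box of $\lambda^*$ in a row $r$ and a column $j+1$ such that column $j$ exists; $A$ is the set of the boxes of $\lambda^*$ in column $j$ and rows $\ge r$, $B$ the set of its boxes in column $j+1$ and rows $\le r$; and $g$ runs over those permutations of the boxes that fix all boxes outside $A\cup B$ and, on $A$ and on $B$ separately, preserve the order of reading down column $j$ and then down column $j+1$ (one representative for each coset of $S_A\times S_B$ in $S_{A\cup B}$). -/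

import Mathlib

namespace PartitionAlgebra

/-! ## Partition diagrams -/

/-- A set-partition diagram on `k` top vertices `1, …, k` (the summand `Sum.inl`) and `k` bottom
vertices `1', …, k'` (the summand `Sum.inr`): the equivalence relation whose classes are the
connected components of the diagram. -/
abbrev Diagram (k : ℕ) : Type := Setoid (Fin k ⊕ Fin k)

/-- The permutation diagram that exchanges `i` and `j`: its blocks are `{i, j'}`, `{j, i'}` and
`{x, x'}` for the other `x`. The generator `𝔰ᵢ` is the case `j = i + 1`. -/
abbrev swapDiagram {k : ℕ} (i j : Fin k) : Diagram k :=
  Setoid.ker (Sum.elim (fun x => x) (fun y => Equiv.swap i j y))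

/-- The generator `𝔭ᵢ`: its blocks are `{i}`, `{i'}` and `{x, x'}` for the other `x`. -/
abbrev isolateDiagram {k : ℕ} (i : Fin k) : Diagram k :=
  Setoid.ker (Sum.elim (fun x => (x, false)) (fun y => (y, decide (y = i))))

/-- The diagram with the blocks `{i, j, i', j'}` and `{x, x'}` for the other `x`. The generator
`𝔟ᵢ` is the case `j = i + 1`. -/
abbrev joinDiagram {k : ℕ} (i j : Fin k) : Diagram k :=
  Setoid.ker (Sum.elim (fun x => if x = j then i else x) (fun y => if y = j then i else y))

/-- The concatenation of a diagram `d` with a one-row set partition `π` placed below it, before the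
components that lie entirely in the lower row are removed: the smallest equivalence relation on the
vertices of `d` that contains `d` and joins the bottom vertices `x', y'` whenever `x, y` lie in the
same block of `π`. -/
def stack {k : ℕ} (d : Diagram k) (π : Finpartition (Finset.univ : Finset (Fin k))) :
    Setoid (Fin k ⊕ Fin k) :=
  Relation.EqvGen.setoid fun a b =>
    d a b ∨ ∃ x y : Fin k, a = Sum.inr x ∧ b = Sum.inr y ∧ π.part x = π.part y

/-- The set partition `top (d ∘ π)` of `{1, …, k}`, as an equivalence relation. -/
def topRow {k : ℕ} (d : Diagram k) (π : Finpartition (Finset.univ : Finset (Fin k))) :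
    Setoid (Fin k) :=
  Setoid.comap Sum.inl (stack d π)

/-- The number of connected components that are removed when `d` is concatenated with `π`, that is,
the components without a top vertex. -/
noncomputable def removed {k : ℕ} (d : Diagram k)
    (π : Finpartition (Finset.univ : Finset (Fin k))) : ℕ :=
  Set.ncard {C : Set (Fin k ⊕ Fin k) | C ∈ (stack d π).classes ∧ ∀ x : Fin k, Sum.inl x ∉ C}

open Classical in
/-- The set of the top vertices that are connected to the set `B` of lower vertices when `d` is
concatenated with `π`. For a block `B` of `π` it is a block of `top (d ∘ π)`, or empty if `B` does
not propagate to the top. -/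
noncomputable def connectedTop {k : ℕ} (d : Diagram k)
    (π : Finpartition (Finset.univ : Finset (Fin k))) (B : Finset (Fin k)) : Finset (Fin k) :=
  Finset.univ.filter fun x => ∃ y ∈ B, stack d π (Sum.inl x) (Sum.inr y)

/-! ## Set-partition tableaux -/

/-- The boxes of `lam` below the first row, that is, the boxes of `lam* = [lam₂, lam₃, …]`. Boxes are
pairs (row, column), both counted from `0`. -/
def belowFirstRow (lam : YoungDiagram) : Finset (ℕ × ℕ) := lam.cells.filter fun c => c.1 ≠ 0

/-- The boxes of the skew shape `lam / [n - t]`, where `n` is the size of `lam`. -/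
def skewCells (lam : YoungDiagram) (t : ℕ) : Finset (ℕ × ℕ) :=
  lam.cells.filter fun c => c.1 = 0 → lam.card - t ≤ c.2

/-- A set-partition tableau of shape `lam`, a partition of `n = lam.card`, whose content is a set
partition of `{1, …, k}` into `t` blocks: a filling of the boxes of `lam / [n - t]` in which each
block occurs exactly once. (The bijectivity forces `|lam*| ≤ t ≤ n`.) The value `∅` outside of the
shape is a convention that makes equal fillings equal. -/
@[ext] structure SetPartitionTableau (lam : YoungDiagram) (k : ℕ) where
  content : Finpartition (Finset.univ : Finset (Fin k))
  entry : ℕ × ℕ → Finset (Fin k)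
  bijOn : Set.BijOn entry (skewCells lam content.parts.card) content.parts
  entry_outside : ∀ c, c ∉ skewCells lam content.parts.card → entry c = ∅

namespace SetPartitionTableau

variable {lam : YoungDiagram} {k : ℕ}

/-- The boxes of the skew shape that is filled by the tableau. -/
def cells (T : SetPartitionTableau lam k) : Finset (ℕ × ℕ) := skewCells lam T.content.parts.card

/-- The blocks below the first row are propagating. -/
def propagating (T : SetPartitionTableau lam k) : Finset (Finset (Fin k)) :=
  (T.cells.filter fun c => c.1 ≠ 0).image T.entry

/-- The blocks in the first row are non-propagating. -/
def nonpropagating (T : SetPartitionTableau lam k) : Finset (Finset (Fin k)) :=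
  (T.cells.filter fun c => c.1 = 0).image T.entry

/-- The first row increases from left to right in the max-entry order. -/
def FirstRowIncreasing (T : SetPartitionTableau lam k) : Prop :=
  ∀ a b : ℕ, a < b → (0, a) ∈ T.cells → (0, b) ∈ T.cells →
    (T.entry (0, a)).max < (T.entry (0, b)).max

/-- The entries increase across the rows and down the columns in the max-entry order. -/
def IsStandard (T : SetPartitionTableau lam k) : Prop :=
  (∀ r a b : ℕ, a < b → (r, a) ∈ T.cells → (r, b) ∈ T.cells →
    (T.entry (r, a)).max < (T.entry (r, b)).max) ∧
  (∀ c a b : ℕ, a < b → (a, c) ∈ T.cells → (b, c) ∈ T.cells →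
    (T.entry (a, c)).max < (T.entry (b, c)).max)

end SetPartitionTableau

/-- The set-partition tableaux whose first row increases from left to right. -/
abbrev SPTBar (lam : YoungDiagram) (k : ℕ) : Type :=
  {T : SetPartitionTableau lam k // T.FirstRowIncreasing}

/-- The standard set-partition tableaux. -/
abbrev SSPT (lam : YoungDiagram) (k : ℕ) : Type :=
  {T : SPTBar lam k // T.1.IsStandard}

/-- The permutations of the boxes below the first row. -/
abbrev BoxPerm (lam : YoungDiagram) : Type := Equiv.Perm {c : ℕ × ℕ // c ∈ belowFirstRow lam}

section Permute

variable {lam : YoungDiagram} {k : ℕ}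

theorem belowFirstRow_subset_skewCells (t : ℕ) : belowFirstRow lam ⊆ skewCells lam t := by
  intro c hc
  simp only [belowFirstRow, skewCells, Finset.mem_filter] at hc ⊢
  exact ⟨hc.1, fun h => absurd h hc.2⟩

theorem ofSubtype_mem_skewCells (g : BoxPerm lam) (t : ℕ) {c : ℕ × ℕ} (hc : c ∈ skewCells lam t) :
    Equiv.Perm.ofSubtype g c ∈ skewCells lam t := by
  by_cases h : c ∈ belowFirstRow lam
  · rw [Equiv.Perm.ofSubtype_apply_of_mem g h]
    exact belowFirstRow_subset_skewCells t (g ⟨c, h⟩).2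
  · rwa [Equiv.Perm.ofSubtype_apply_of_not_mem g h]

theorem ofSubtype_inv_apply (g : BoxPerm lam) (c : ℕ × ℕ) :
    Equiv.Perm.ofSubtype g (Equiv.Perm.ofSubtype g⁻¹ c) = c := by
  rw [← Equiv.Perm.mul_apply, ← map_mul]
  simp

theorem ofSubtype_bijOn (g : BoxPerm lam) (t : ℕ) :
    Set.BijOn (Equiv.Perm.ofSubtype g) (skewCells lam t) (skewCells lam t) := by
  refine ⟨fun c hc => ofSubtype_mem_skewCells g t hc, (Equiv.injective _).injOn, fun c hc => ?_⟩
  exact ⟨Equiv.Perm.ofSubtype g⁻¹ c, ofSubtype_mem_skewCells g⁻¹ t hc, ofSubtype_inv_apply g c⟩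

theorem ofSubtype_first_row (g : BoxPerm lam) (a : ℕ) :
    Equiv.Perm.ofSubtype g ((0, a) : ℕ × ℕ) = (0, a) :=
  Equiv.Perm.ofSubtype_apply_of_not_mem g (by simp [belowFirstRow])

/-- The tableau `T ∘ g`, obtained by permuting the entries below the first row: the box `c` receives
the entry of `T` in the box `g c`. -/
def permute (T : SPTBar lam k) (g : BoxPerm lam) : SPTBar lam k :=
  ⟨{ content := T.1.content
     entry := fun c => T.1.entry (Equiv.Perm.ofSubtype g c)
     bijOn := T.1.bijOn.comp (ofSubtype_bijOn g _)
     entry_outside := fun c hc => by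
       rw [Equiv.Perm.ofSubtype_apply_of_not_mem g
         (fun h => hc (belowFirstRow_subset_skewCells _ h))]
       exact T.1.entry_outside c hc },
    fun a b hab ha hb => by
      simpa only [ofSubtype_first_row] using T.2 a b hab ha hb⟩

end Permute

/-! ## The vectors `N_T` and the action of diagrams -/

section Action

variable {lam : YoungDiagram} {k : ℕ}

/-- The permutations of the boxes of `lam*` that preserve each row. -/
def rowGroup (lam : YoungDiagram) : Finset (BoxPerm lam) :=
  Finset.univ.filter fun g => ∀ c, (g c).1.1 = c.1.1

/-- The permutations of the boxes of `lam*` that preserve each column. -/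
def columnGroup (lam : YoungDiagram) : Finset (BoxPerm lam) :=
  Finset.univ.filter fun g => ∀ c, (g c).1.2 = c.1.2

/-- The vector `∑ sign(γ) [T ∘ (γ ρ)]`, summed over the column permutations `γ` and the row
permutations `ρ` of `lam*`, in the vector space with the basis `[T]`, `T ∈ SPTBar lam k`. -/
noncomputable def youngVector (T : SPTBar lam k) : SPTBar lam k →₀ ℂ :=
  ∑ g ∈ columnGroup lam, ∑ h ∈ rowGroup lam,
    ((Equiv.Perm.sign g : ℤ) : ℂ) • Finsupp.single (permute T (g * h)) (1 : ℂ)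

/-- `S = d(T)`: the content of `S` is `top (d ∘ π)` for the content `π` of `T`, each propagating
block of `T` is replaced with the block of `top (d ∘ π)` to which it is connected, and the other
blocks of `top (d ∘ π)` increase from left to right in the first row (as `S` lies in `SPTBar`). No
such `S` exists if two propagating blocks become connected or if a propagating block does not
propagate to the top; then `d(T) = 0`. -/
def IsImage (d : Diagram k) (T S : SPTBar lam k) : Prop :=
  Setoid.ker S.1.content.part = topRow d T.1.content ∧
  ∀ c ∈ belowFirstRow lam, S.1.entry c = connectedTop d T.1.content (T.1.entry c)

open Classical in
/-- The linear operator `[T] ↦ n ^ ℓ(d, T) [d(T)]`, where `n` is the size of `lam`. -/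
noncomputable def tableauAction (d : Diagram k) :
    (SPTBar lam k →₀ ℂ) →ₗ[ℂ] (SPTBar lam k →₀ ℂ) :=
  Finsupp.linearCombination ℂ fun T =>
    if h : ∃ S, IsImage d T S then
      ((lam.card : ℂ) ^ removed d T.1.content) • Finsupp.single h.choose (1 : ℂ)
    else 0

theorem ker_part_injective (p q : Finpartition (Finset.univ : Finset (Fin k)))
    (h : Setoid.ker p.part = Setoid.ker q.part) : p = q := by
  have key : ∀ x y : Fin k, p.part x = p.part y ↔ q.part x = q.part y := fun x y => by
    have := congrArg (fun s : Setoid (Fin k) => s x y) h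
    simpa [Setoid.ker_def] using this
  have hpart : ∀ x, p.part x = q.part x := fun x => by
    ext y
    rw [p.mem_part_iff_part_eq_part (Finset.mem_univ _) (Finset.mem_univ _),
      q.mem_part_iff_part_eq_part (Finset.mem_univ _) (Finset.mem_univ _)]
    exact key _ _
  have hsub : ∀ p q : Finpartition (Finset.univ : Finset (Fin k)),
      (∀ x, p.part x = q.part x) → p.parts ⊆ q.parts := fun p q hpq B hB => by
    obtain ⟨x, hx⟩ := p.nonempty_of_mem_parts hB
    rw [← p.part_eq_of_mem hB hx, hpq]
    exact q.part_mem.2 (Finset.mem_univ _)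
  exact Finpartition.ext (Finset.Subset.antisymm (hsub p q hpart)
    (hsub q p fun x => (hpart x).symm))

/-- A tableau with increasing first row is determined by its content and its entries below the
first row. -/
theorem SPTBar_ext (S S' : SPTBar lam k) (hc : S.1.content = S'.1.content)
    (hb : ∀ c ∈ belowFirstRow lam, S.1.entry c = S'.1.entry c) : S = S' := by
  have hmax : ∀ B ∈ S.1.content.parts, ∀ B' ∈ S.1.content.parts, B.max = B'.max → B = B' := by
    intro B hB B' hB' h
    obtain ⟨x, hx⟩ := Finset.max_of_nonempty (S.1.content.nonempty_of_mem_parts hB)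
    exact S.1.content.eq_of_mem_parts hB hB' (Finset.mem_of_max hx)
      (Finset.mem_of_max (h ▸ hx))
  obtain ⟨⟨p, e, h1, h2⟩, h3⟩ := S
  obtain ⟨⟨p', e', h1', h2'⟩, h3'⟩ := S'
  obtain rfl : p = p' := hc
  simp only at hb hmax
  have himg : ∀ f f' : ℕ × ℕ → Finset (Fin k),
      Set.BijOn f (skewCells lam p.parts.card) p.parts →
      Set.BijOn f' (skewCells lam p.parts.card) p.parts →
      (∀ c ∈ belowFirstRow lam, f c = f' c) →
      ∀ a, (0, a) ∈ skewCells lam p.parts.card →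
        ∃ b, (0, b) ∈ skewCells lam p.parts.card ∧ f' (0, b) = f (0, a) := by
    intro f f' hf hf' hff a ha
    obtain ⟨⟨r, b⟩, hrb, heq⟩ := hf'.surjOn (hf.mapsTo ha)
    by_cases hr : r = 0
    · subst hr; exact ⟨b, hrb, heq⟩
    · exfalso
      have hmem : ((r, b) : ℕ × ℕ) ∈ belowFirstRow lam := by
        simp only [skewCells, Finset.mem_coe, Finset.mem_filter] at hrb
        simp [belowFirstRow, hrb.1, hr]
      rw [← hff _ hmem] at heq
      have := hf.injOn hrb ha heq
      simp only [Prod.mk.injEq] at this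
      exact hr this.1
  have hrow : ∀ a, (0, a) ∈ skewCells lam p.parts.card → e (0, a) = e' (0, a) := by
    let I := {a : ℕ // (0, a) ∈ skewCells lam p.parts.card}
    let F : I → WithBot (Fin k) := fun a => (e (0, a.1)).max
    let F' : I → WithBot (Fin k) := fun a => (e' (0, a.1)).max
    have hF : StrictMono F := fun a b hab => h3 a.1 b.1 hab a.2 b.2
    have hF' : StrictMono F' := fun a b hab => h3' a.1 b.1 hab a.2 b.2
    have hrange : Set.range F = Set.range F' := by
      ext v
      constructor
      · rintro ⟨⟨a, ha⟩, rfl⟩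
        obtain ⟨b, hb', hbe⟩ := himg e e' h1 h1' hb a ha
        exact ⟨⟨b, hb'⟩, by simp only [F, F', hbe]⟩
      · rintro ⟨⟨a, ha⟩, rfl⟩
        obtain ⟨b, hb', hbe⟩ := himg e' e h1' h1 (fun c hc => (hb c hc).symm) a ha
        exact ⟨⟨b, hb'⟩, by simp only [F, F', hbe]⟩
    have hFF : F = F' := (StrictMono.range_inj hF hF').1 hrange
    intro a ha
    exact hmax _ (h1.mapsTo ha) _ (h1'.mapsTo ha) (congrFun hFF ⟨a, ha⟩)
  have hee : e = e' := by
    funext c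
    by_cases hcs : c ∈ skewCells lam p.parts.card
    · by_cases hcb : c ∈ belowFirstRow lam
      · exact hb c hcb
      · obtain ⟨r, a⟩ := c
        have hr : r = 0 := by
          by_contra hr
          refine hcb ?_
          simp only [skewCells, Finset.mem_filter] at hcs
          simp [belowFirstRow, hcs.1, hr]
        subst hr
        exact hrow a hcs
    · rw [h2 c hcs, h2' c hcs]
  subst hee
  rfl

/-- `d(T)` is unique. -/
theorem IsImage.unique {d : Diagram k} {T S S' : SPTBar lam k} (h : IsImage d T S)
    (h' : IsImage d T S') : S = S' :=
  SPTBar_ext S S' (ker_part_injective _ _ (h.1.trans h'.1.symm))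
    fun c hc => (h.2 c hc).trans (h'.2 c hc).symm

theorem IsImage.permute {d : Diagram k} {T S : SPTBar lam k} (h : IsImage d T S)
    (g : BoxPerm lam) : IsImage d (permute T g) (permute S g) := by
  refine ⟨h.1, fun c hc => ?_⟩
  change S.1.entry (Equiv.Perm.ofSubtype g c) =
    connectedTop d T.1.content (T.1.entry (Equiv.Perm.ofSubtype g c))
  rw [Equiv.Perm.ofSubtype_apply_of_mem g hc]
  exact h.2 _ (g ⟨c, hc⟩).2

theorem permute_permute_inv (T : SPTBar lam k) (g : BoxPerm lam) :
    permute (permute T g) g⁻¹ = T := by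
  refine Subtype.ext (SetPartitionTableau.ext rfl (funext fun c => ?_))
  change T.1.entry (Equiv.Perm.ofSubtype g (Equiv.Perm.ofSubtype g⁻¹ c)) = T.1.entry c
  rw [ofSubtype_inv_apply]

theorem tableauAction_single_of_isImage {d : Diagram k} {T S : SPTBar lam k}
    (h : IsImage d T S) :
    tableauAction d (Finsupp.single T 1) =
      ((lam.card : ℂ) ^ removed d T.1.content) • Finsupp.single S (1 : ℂ) := by
  have hex : ∃ S, IsImage d T S := ⟨S, h⟩
  rw [tableauAction, Finsupp.linearCombination_single, one_smul, dif_pos hex,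
    hex.choose_spec.unique h]

theorem tableauAction_single_of_not {d : Diagram k} {T : SPTBar lam k}
    (h : ¬ ∃ S, IsImage d T S) : tableauAction d (Finsupp.single T 1) = 0 := by
  rw [tableauAction, Finsupp.linearCombination_single, one_smul, dif_neg h]

/-- `d · N_T = n ^ ℓ(d, T) N_{d(T)}` if `d(T)` is a set-partition tableau. -/
theorem tableauAction_youngVector_of_isImage {d : Diagram k} {T S : SPTBar lam k}
    (h : IsImage d T S) :
    tableauAction d (youngVector T) =
      ((lam.card : ℂ) ^ removed d T.1.content) • youngVector S := by
  simp only [youngVector, map_sum, Finset.smul_sum]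
  refine Finset.sum_congr rfl fun g _ => Finset.sum_congr rfl fun g' _ => ?_
  rw [map_smul, tableauAction_single_of_isImage (h.permute (g * g')), smul_comm]
  rfl

/-- `d · N_T = 0` if `d(T)` is not a set-partition tableau. -/
theorem tableauAction_youngVector_of_not {d : Diagram k} {T : SPTBar lam k}
    (h : ¬ ∃ S, IsImage d T S) : tableauAction d (youngVector T) = 0 := by
  simp only [youngVector, map_sum]
  refine Finset.sum_eq_zero fun g _ => Finset.sum_eq_zero fun g' _ => ?_
  rw [map_smul, tableauAction_single_of_not, smul_zero]
  rintro ⟨S, hS⟩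
  refine h ⟨PartitionAlgebra.permute S (g * g')⁻¹, ?_⟩
  have := hS.permute (g * g')⁻¹
  rwa [permute_permute_inv] at this

/-- The module `P_k^lam`, spanned by the vectors `N_T`, as a subspace of the vector space with the
basis `SPTBar lam k`. -/
noncomputable def naturalModule (lam : YoungDiagram) (k : ℕ) : Submodule ℂ (SPTBar lam k →₀ ℂ) :=
  Submodule.span ℂ (Set.range youngVector)

/-- The vector `N_T` of `P_k^lam`, for a tableau `T` with increasing first row. -/
noncomputable def natVec (T : SPTBar lam k) : naturalModule lam k :=
  ⟨youngVector T, Submodule.subset_span ⟨T, rfl⟩⟩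

theorem tableauAction_mem (d : Diagram k) (v : SPTBar lam k →₀ ℂ) (hv : v ∈ naturalModule lam k) :
    tableauAction d v ∈ naturalModule lam k := by
  have hle : naturalModule lam k ≤ (naturalModule lam k).comap (tableauAction d) := by
    refine Submodule.span_le.2 ?_
    rintro _ ⟨T, rfl⟩
    by_cases h : ∃ S, IsImage d T S
    · obtain ⟨S, hS⟩ := h
      change tableauAction d (youngVector T) ∈ naturalModule lam k
      rw [tableauAction_youngVector_of_isImage hS]
      exact Submodule.smul_mem _ _ (Submodule.subset_span ⟨S, rfl⟩)
    · change tableauAction d (youngVector T) ∈ naturalModule lam k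
      rw [tableauAction_youngVector_of_not h]
      exact Submodule.zero_mem _
  exact hle hv

/-- The action of a diagram `d` on the module `P_k^lam`. -/
noncomputable def act (d : Diagram k) : naturalModule lam k →ₗ[ℂ] naturalModule lam k :=
  (tableauAction d).restrict (tableauAction_mem d)

/-- The action on `P_k^lam` is given by the formula
`d · N_T = n ^ ℓ(d, T) N_{d(T)}` if `d(T)` is a set-partition tableau and `d · N_T = 0` if not. -/
theorem act_natVec (d : Diagram k) (T : SPTBar lam k) :
    (∀ S, IsImage d T S →
      act d (natVec T) = ((lam.card : ℂ) ^ removed d T.1.content) • natVec S) ∧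
    ((¬ ∃ S, IsImage d T S) → act d (natVec T) = 0) :=
  ⟨fun _ hS => Subtype.ext (tableauAction_youngVector_of_isImage hS),
    fun h => Subtype.ext (tableauAction_youngVector_of_not h)⟩

end Action

/-! ## Garnir relations -/

section Garnir

variable {lam : YoungDiagram} {k : ℕ}

/-- The boxes of the Garnir belt at the adjacent columns `j`, `j + 1` and the row `r`: the boxes of
column `j` in the rows `≥ r` and the boxes of column `j + 1` in the rows `≤ r`. -/
def InBelt (r j : ℕ) (c : ℕ × ℕ) : Prop := (c.2 = j ∧ r ≤ c.1) ∨ (c.2 = j + 1 ∧ c.1 ≤ r)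

/-- The permutations of the Garnir belt that represent the cosets of the subgroup preserving its two
columns: in each of the two columns they keep the boxes in the order of reading down column `j` and
then down column `j + 1`. -/
def IsGarnirRep (r j : ℕ) (g : BoxPerm lam) : Prop :=
  (∀ c, ¬ InBelt r j c.1 → g c = c) ∧
  ∀ c c' : {c : ℕ × ℕ // c ∈ belowFirstRow lam}, InBelt r j c.1 → InBelt r j c'.1 →
    c.1.2 = c'.1.2 → c.1.1 < c'.1.1 →
    (g c).1.2 < (g c').1.2 ∨ ((g c).1.2 = (g c').1.2 ∧ (g c).1.1 < (g c').1.1)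

open Classical in
/-- The Garnir relations with integer coefficients, among formal symbols `[T]`, `T ∈ SPTBar lam k`:
the column relations `[T ∘ γ] = sign(γ) [T]` and the relations `∑ sign(g) [T ∘ g] = 0` over the
coset representatives `g` of a Garnir belt. -/
noncomputable def garnirRelations (lam : YoungDiagram) (k : ℕ) :
    Submodule ℤ (SPTBar lam k →₀ ℤ) :=
  Submodule.span ℤ
    ({v | ∃ (T : SPTBar lam k) (g : BoxPerm lam), g ∈ columnGroup lam ∧
        v = Finsupp.single (permute T g) 1 - Finsupp.single T (Equiv.Perm.sign g : ℤ)} ∪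
     {v | ∃ (T : SPTBar lam k) (r j : ℕ), (r, j + 1) ∈ belowFirstRow lam ∧
        v = ∑ g ∈ Finset.univ.filter (fun g : BoxPerm lam => IsGarnirRep r j g),
          Finsupp.single (permute T g) (Equiv.Perm.sign g : ℤ)})

/-- `N_S` is an integer linear combination of the vectors `N_U` with `U` standard, and this
combination is obtained from the Garnir relations. -/
def Straightens (S : SPTBar lam k) : Prop :=
  ∃ c : SSPT lam k →₀ ℤ,
    natVec S = c.sum (fun U a => a • natVec U.1) ∧
    Finsupp.single S 1 - c.sum (fun U a => Finsupp.single U.1 a) ∈ garnirRelations lam k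

end Garnir

/-! ## The combinatorial description of the action of the generators

In each of the following relations `S` lies in `SPTBar`, so that its first row is standardized. -/

section Generators

variable {lam : YoungDiagram} {k : ℕ}

/-- `S` is obtained from `T` by swapping `i` and `j` (and standardizing the first row). -/
def IsSwap (i j : Fin k) (T S : SPTBar lam k) : Prop :=
  (∀ c ∈ belowFirstRow lam, S.1.entry c = (T.1.entry c).image (Equiv.swap i j)) ∧
  S.1.nonpropagating = T.1.nonpropagating.image fun B => B.image (Equiv.swap i j)

/-- `S` is obtained from `T` by removing `i` from its block and placing the singleton block `{i}`
into the first row (and standardizing the first row). -/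
def IsIsolate (i : Fin k) (T S : SPTBar lam k) : Prop :=
  (∀ c ∈ belowFirstRow lam, S.1.entry c = (T.1.entry c).erase i) ∧
  S.1.nonpropagating = insert {i} (T.1.nonpropagating.image fun B => B.erase i)

/-- `S` is obtained from `T` by joining the block `B` of `i` with the block `B'` of `j` (and
standardizing the first row). A propagating block among `B` and `B'` is replaced in its box by the
union `B ∪ B'`. If neither is propagating, the union is non-propagating. -/
def IsJoin (i j : Fin k) (T S : SPTBar lam k) : Prop :=
  let B := T.1.content.part i
  let B' := T.1.content.part j
  (∀ c ∈ belowFirstRow lam,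
    S.1.entry c = if T.1.entry c = B ∨ T.1.entry c = B' then B ∪ B' else T.1.entry c) ∧
  S.1.nonpropagating =
    if B ∈ T.1.propagating ∨ B' ∈ T.1.propagating then T.1.nonpropagating \ {B, B'}
    else insert (B ∪ B') (T.1.nonpropagating \ {B, B'})

end Generators

end PartitionAlgebra

/-! The basis statement is the classical theory of Specht modules, applied to the boxes of `lam*`
and to the maxima of the blocks in them.

Linear independence is a triangularity argument. In `N_T` the symbol `[T]` has coefficient 1. By the
rearrangement inequality a nontrivial column permutation of a column-increasing tableau strictly
lowers the sum of row times entry (`rowWeight`), while row permutations leave this sum unchanged. So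
every other standard tableau that occurs in `N_T` has smaller weight
(`eq_or_rowWeight_lt_of_youngVector_ne_zero`).

Spanning is Garnir straightening over the integers. The Garnir relations hold for the vectors `N_T`:
the signed sum over all permutations of a belt vanishes by a sign-reversing involution, which exists
because every column permutation takes two boxes of some row into the belt, one into each of its
columns (`sum_beltGroup_rowGroup_eq_zero`, `exists_same_row`). If the columns of a tableau increase
but some row has a descent, the relation at that descent replaces the tableau by tableaux with a
larger sum of column times entry (`columnWeight_lt_permute`). This sum is bounded, so the process
ends with standard tableaux (`single_mem_sup`). The computation takes place among formal symbols,
hence it yields both the integer coefficients and the membership in the span of the Garnir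
relations.

For the action, the components of a generator stacked on a set partition are described as the fibres
of an explicit map (`stack_swap_iff`, `stack_isolate_iff`, `stack_join_iff`). From this one reads
off the top row, the images of the propagating blocks and the number of removed components. The
image tableau exists when the images of the propagating blocks are nonempty and distinct
(`exists_isImage`). -/

namespace PartitionAlgebra

/-! ### Permutations that sort the fibres of a map -/

section Sorting

variable {α β : Type*}

/-- Strong induction on the rank `r a`. A point sent to lower rank would have a fixed image, so it
would itself be fixed. If a point is sent to higher rank, its preimage either has lower rank and is
fixed already, or has higher rank and violates monotonicity. -/
theorem perm_eq_one_of_monotone (p : α → β) (r : α → ℕ)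
    (hpr : ∀ a b, p a = p b → r a = r b → a = b) (σ : Equiv.Perm α) (hσ : ∀ a, p (σ a) = p a)
    (hmono : ∀ a b, p a = p b → r a < r b → r (σ a) < r (σ b)) : σ = 1 := by
  have key : ∀ (m : ℕ) (a : α), r a = m → σ a = a := by
    intro m
    induction m using Nat.strong_induction_on with
    | _ m ih =>
      rintro a rfl
      rcases lt_trichotomy (r (σ a)) (r a) with h | h | h
      · exact σ.injective (ih _ h _ rfl)
      · exact hpr _ _ (hσ a) h
      · obtain ⟨b, rfl⟩ := σ.surjective a
        have hb : p b = p (σ b) := (hσ b).symm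
        rcases lt_trichotomy (r b) (r (σ b)) with h' | h' | h'
        · rw [ih _ h' b rfl] at h'
          exact absurd h' (lt_irrefl _)
        · rw [← hpr _ _ hb h', ← hpr _ _ hb h']
        · exact absurd (hmono _ _ hb.symm h') (lt_asymm h)
  exact Equiv.ext fun a => key _ a rfl

/-- The exchange step of the rearrangement inequality: if `a` and `b` are in the wrong order,
composing `σ` with their transposition raises the sum by `(r b - r a) * (F (σ a) - F (σ b)) > 0`.
The set `s` restricts the sorting to some of the points, which is needed for Garnir belts. -/
theorem increasing_of_sum_max [Fintype α] [DecidableEq α] {p : α → β} {r F : α → ℕ}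
    (hF : Function.Injective F) {s : Set α} {σ : Equiv.Perm α} (hσ : ∀ a, p (σ a) = p a)
    (hσs : ∀ a, a ∉ s → σ a = a)
    (hmax : ∀ τ : Equiv.Perm α, (∀ a, p (τ a) = p a) → (∀ a, a ∉ s → τ a = a) →
      ∑ a, (r a : ℤ) * F (τ a) ≤ ∑ a, (r a : ℤ) * F (σ a)) :
    ∀ a b, a ∈ s → b ∈ s → p a = p b → r a < r b → F (σ a) < F (σ b) := by
  intro a b ha hb hab hr
  by_contra hlt
  have hne : a ≠ b := by rintro rfl; exact lt_irrefl _ hr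
  have hlt : F (σ b) < F (σ a) :=
    lt_of_le_of_ne (not_lt.1 hlt) fun h => hne (σ.injective (hF h)).symm
  have hs : ∀ c, p (Equiv.swap a b c) = p c := fun c => by
    by_cases hca : c = a
    · subst hca; rw [Equiv.swap_apply_left, hab]
    · by_cases hcb : c = b
      · subst hcb; rw [Equiv.swap_apply_right, hab]
      · rw [Equiv.swap_apply_of_ne_of_ne hca hcb]
  have h1 := hmax (σ * Equiv.swap a b) (fun c => by rw [Equiv.Perm.mul_apply, hσ, hs])
    fun c hc => by
      rw [Equiv.Perm.mul_apply, Equiv.swap_apply_of_ne_of_ne (by rintro rfl; exact hc ha)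
        (by rintro rfl; exact hc hb), hσs c hc]
  rw [← sub_nonpos, ← Finset.sum_sub_distrib, Fintype.sum_eq_add a b hne] at h1
  · simp only [Equiv.Perm.mul_apply, Equiv.swap_apply_left, Equiv.swap_apply_right] at h1
    have h2 : (0 : ℤ) < (r b - r a) * (F (σ a) - F (σ b)) :=
      mul_pos (by simpa using hr) (by simpa using hlt)
    linarith
  · rintro c ⟨hca, hcb⟩
    rw [Equiv.Perm.mul_apply, Equiv.swap_apply_of_ne_of_ne hca hcb, sub_self]

theorem exists_sum_max_perm [Fintype α] [DecidableEq α] (p : α → β) (r F : α → ℕ) (s : Set α) :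
    ∃ σ : Equiv.Perm α, (∀ a, p (σ a) = p a) ∧ (∀ a, a ∉ s → σ a = a) ∧
      ∀ τ : Equiv.Perm α, (∀ a, p (τ a) = p a) → (∀ a, a ∉ s → τ a = a) →
        ∑ a, (r a : ℤ) * F (τ a) ≤ ∑ a, (r a : ℤ) * F (σ a) := by
  classical
  let G : Finset (Equiv.Perm α) :=
    Finset.univ.filter fun σ => (∀ a, p (σ a) = p a) ∧ ∀ a, a ∉ s → σ a = a
  obtain ⟨σ, hσ, hmax⟩ := G.exists_max_image (fun σ => ∑ a, (r a : ℤ) * F (σ a))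
    ⟨1, by simp [G]⟩
  simp only [G, Finset.mem_filter, Finset.mem_univ, true_and] at hσ hmax
  exact ⟨σ, hσ.1, hσ.2, fun τ h1 h2 => hmax τ ⟨h1, h2⟩⟩

theorem exists_sorting_perm [Fintype α] [DecidableEq α] (p : α → β) (r F : α → ℕ)
    (hF : Function.Injective F) (s : Set α) :
    ∃ σ : Equiv.Perm α, (∀ a, p (σ a) = p a) ∧ (∀ a, a ∉ s → σ a = a) ∧
      ∀ a b, a ∈ s → b ∈ s → p a = p b → r a < r b → F (σ a) < F (σ b) := by
  obtain ⟨σ, h1, h2, h3⟩ := exists_sum_max_perm p r F s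
  exact ⟨σ, h1, h2, increasing_of_sum_max hF h1 h2 h3⟩

end Sorting

/-! ### Permuted tableaux, maxima of blocks and standardness -/

section Permute

variable {lam : YoungDiagram} {k : ℕ}

theorem mem_belowFirstRow {c : ℕ × ℕ} : c ∈ belowFirstRow lam ↔ c ∈ lam ∧ c.1 ≠ 0 := by
  simp [belowFirstRow]

theorem box_ext {c c' : {c : ℕ × ℕ // c ∈ belowFirstRow lam}} (h2 : c.1.2 = c'.1.2)
    (h1 : c.1.1 = c'.1.1) : c = c' :=
  Subtype.ext (Prod.ext h1 h2)

theorem permute_entry (T : SPTBar lam k) (g : BoxPerm lam)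
    (c : {c : ℕ × ℕ // c ∈ belowFirstRow lam}) :
    (permute T g).1.entry c = T.1.entry (g c) := by
  change T.1.entry (Equiv.Perm.ofSubtype g c) = _
  rw [Equiv.Perm.ofSubtype_apply_of_mem g c.2]

theorem permute_permute (T : SPTBar lam k) (g h : BoxPerm lam) :
    permute (permute T g) h = permute T (g * h) := by
  refine SPTBar_ext _ _ rfl fun c hc => ?_
  exact ((permute_entry (permute T g) h ⟨c, hc⟩).trans (permute_entry T g _)).trans
    (permute_entry T (g * h) ⟨c, hc⟩).symm

theorem permute_one (T : SPTBar lam k) : permute T 1 = T :=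
  SPTBar_ext _ _ rfl fun c hc => permute_entry T 1 ⟨c, hc⟩

theorem entry_injective (T : SPTBar lam k) :
    Function.Injective fun c : {c : ℕ × ℕ // c ∈ belowFirstRow lam} => T.1.entry c :=
  fun c c' h => Subtype.ext (T.1.bijOn.injOn (belowFirstRow_subset_skewCells _ c.2)
    (belowFirstRow_subset_skewCells _ c'.2) h)

theorem entry_mem_parts (T : SPTBar lam k) {c : ℕ × ℕ} (hc : c ∈ belowFirstRow lam) :
    T.1.entry c ∈ T.1.content.parts :=
  T.1.bijOn.mapsTo (belowFirstRow_subset_skewCells _ hc)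

theorem permute_injective (T : SPTBar lam k) : Function.Injective (permute T) := by
  intro g h hgh
  refine Equiv.ext fun c => entry_injective T ?_
  simp only [← permute_entry, hgh]

theorem one_mem_columnGroup : (1 : BoxPerm lam) ∈ columnGroup lam := by simp [columnGroup]

theorem one_mem_rowGroup : (1 : BoxPerm lam) ∈ rowGroup lam := by simp [rowGroup]

theorem mem_columnGroup {g : BoxPerm lam} : g ∈ columnGroup lam ↔ ∀ c, (g c).1.2 = c.1.2 := by
  simp [columnGroup]

theorem mem_rowGroup {g : BoxPerm lam} : g ∈ rowGroup lam ↔ ∀ c, (g c).1.1 = c.1.1 := by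
  simp [rowGroup]

theorem inv_mem_columnGroup {g : BoxPerm lam} (hg : g ∈ columnGroup lam) :
    g⁻¹ ∈ columnGroup lam := by
  rw [mem_columnGroup] at *
  intro c
  simpa using (hg (g⁻¹ c)).symm

theorem mul_mem_columnGroup {g h : BoxPerm lam} (hg : g ∈ columnGroup lam)
    (hh : h ∈ columnGroup lam) : g * h ∈ columnGroup lam := by
  rw [mem_columnGroup] at *
  intro c
  rw [Equiv.Perm.mul_apply, hg, hh]

theorem mul_mem_rowGroup {g h : BoxPerm lam} (hg : g ∈ rowGroup lam)
    (hh : h ∈ rowGroup lam) : g * h ∈ rowGroup lam := by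
  rw [mem_rowGroup] at *
  intro c
  rw [Equiv.Perm.mul_apply, hg, hh]

/-- The maximum of the block in a box, as a natural number. -/
def boxMax (T : SPTBar lam k) (c : {c : ℕ × ℕ // c ∈ belowFirstRow lam}) : ℕ :=
  (T.1.entry c).sup Fin.val

theorem max_lt_max_iff_sup {B B' : Finset (Fin k)} (hB : B.Nonempty) (hB' : B'.Nonempty) :
    B.max < B'.max ↔ B.sup Fin.val < B'.sup Fin.val := by
  have key : ∀ B : Finset (Fin k), B.Nonempty → ∃ x : Fin k, B.max = x ∧ B.sup Fin.val = x := by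
    intro B hB
    obtain ⟨x, hx⟩ := Finset.max_of_nonempty hB
    refine ⟨x, hx, le_antisymm (Finset.sup_le fun y hy => ?_)
      (Finset.le_sup (f := Fin.val) (Finset.mem_of_max hx))⟩
    have hyx := Finset.le_max hy
    rw [hx] at hyx
    exact Fin.le_def.1 (WithBot.coe_le_coe.1 hyx)
  obtain ⟨x, hx, hx'⟩ := key B hB
  obtain ⟨y, hy, hy'⟩ := key B' hB'
  rw [hx, hy, hx', hy', WithBot.coe_lt_coe, Fin.lt_def]

theorem max_lt_max_iff_boxMax (T : SPTBar lam k)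
    (c c' : {c : ℕ × ℕ // c ∈ belowFirstRow lam}) :
    (T.1.entry c).max < (T.1.entry c').max ↔ boxMax T c < boxMax T c' :=
  max_lt_max_iff_sup (T.1.content.nonempty_of_mem_parts (entry_mem_parts T c.2))
    (T.1.content.nonempty_of_mem_parts (entry_mem_parts T c'.2))

theorem eq_of_max_eq (p : Finpartition (Finset.univ : Finset (Fin k))) {B B' : Finset (Fin k)}
    (hB : B ∈ p.parts) (hB' : B' ∈ p.parts) (h : B.max = B'.max) : B = B' := by
  obtain ⟨x, hx⟩ := Finset.max_of_nonempty (p.nonempty_of_mem_parts hB)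
  exact p.eq_of_mem_parts hB hB' (Finset.mem_of_max hx) (Finset.mem_of_max (h ▸ hx))

theorem boxMax_injective (T : SPTBar lam k) : Function.Injective (boxMax T) := by
  intro c c' h
  refine entry_injective T (eq_of_max_eq _ (entry_mem_parts T c.2) (entry_mem_parts T c'.2) ?_)
  refine le_antisymm (not_lt.1 ?_) (not_lt.1 ?_) <;>
  · rw [max_lt_max_iff_boxMax, h]
    exact lt_irrefl _

theorem boxMax_permute (T : SPTBar lam k) (g : BoxPerm lam)
    (c : {c : ℕ × ℕ // c ∈ belowFirstRow lam}) : boxMax (permute T g) c = boxMax T (g c) := by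
  rw [boxMax, permute_entry, boxMax]

theorem boxMax_le (T : SPTBar lam k) (c : {c : ℕ × ℕ // c ∈ belowFirstRow lam}) :
    boxMax T c ≤ k :=
  Finset.sup_le fun x _ => x.2.le

/-- The entries below the first row increase down the columns. -/
def ColumnsIncrease (T : SPTBar lam k) : Prop :=
  ∀ c c' : {c : ℕ × ℕ // c ∈ belowFirstRow lam},
    c.1.2 = c'.1.2 → c.1.1 < c'.1.1 → boxMax T c < boxMax T c'

/-- The entries below the first row increase along the rows. -/
def RowsIncrease (T : SPTBar lam k) : Prop :=
  ∀ c c' : {c : ℕ × ℕ // c ∈ belowFirstRow lam},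
    c.1.1 = c'.1.1 → c.1.2 < c'.1.2 → boxMax T c < boxMax T c'

theorem columnsIncrease_of_isStandard {T : SPTBar lam k} (h : T.1.IsStandard) :
    ColumnsIncrease T := by
  rintro ⟨⟨r, a⟩, hc⟩ ⟨⟨r', a'⟩, hc'⟩ (rfl : a = a') h2
  rw [← max_lt_max_iff_boxMax]
  exact h.2 a r r' h2 (belowFirstRow_subset_skewCells _ hc) (belowFirstRow_subset_skewCells _ hc')

theorem rowsIncrease_of_isStandard {T : SPTBar lam k} (h : T.1.IsStandard) :
    RowsIncrease T := by
  rintro ⟨⟨r, a⟩, hc⟩ ⟨⟨r', a'⟩, hc'⟩ (rfl : r = r') h2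
  rw [← max_lt_max_iff_boxMax]
  exact h.1 r a a' h2 (belowFirstRow_subset_skewCells _ hc) (belowFirstRow_subset_skewCells _ hc')

theorem mem_belowFirstRow_of_mem_skewCells {t : ℕ} {c : ℕ × ℕ} (hc : c ∈ skewCells lam t)
    (h : c.1 ≠ 0) : c ∈ belowFirstRow lam := by
  simp only [skewCells, Finset.mem_filter] at hc
  exact mem_belowFirstRow.2 ⟨hc.1, h⟩

theorem card_parts_le (p : Finpartition (Finset.univ : Finset (Fin k))) : p.parts.card ≤ k := by
  simpa using p.card_parts_le_card

/-- The number of columns below the first row is at most the number of boxes there. -/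
theorem column_lt_card_belowFirstRow {c : ℕ × ℕ} (hc : c ∈ belowFirstRow lam) :
    c.2 < (belowFirstRow lam).card := by
  have hsub : (Finset.range (c.2 + 1)).image (fun a => (c.1, a)) ⊆ belowFirstRow lam := by
    intro d hd
    obtain ⟨a, ha, rfl⟩ := Finset.mem_image.1 hd
    rw [mem_belowFirstRow] at hc ⊢
    exact ⟨lam.up_left_mem le_rfl (Nat.lt_succ_iff.1 (Finset.mem_range.1 ha)) hc.1, hc.2⟩
  have := Finset.card_le_card hsub
  rwa [Finset.card_image_of_injective _ (fun a b h => (Prod.mk.inj h).2), Finset.card_range] at this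

/-- Only a column through both a first-row box and a lower box needs an argument, and there is none.
A first-row box of the skew shape has column at least `n - t ≥ n - k ≥ k`, while a box of `lam*` has
column less than `|lam*| ≤ k`. -/
theorem isStandard_of_increase (hn : 2 * k ≤ lam.card) (hlam : (belowFirstRow lam).card ≤ k)
    {T : SPTBar lam k} (hcol : ColumnsIncrease T) (hrow : RowsIncrease T) : T.1.IsStandard := by
  constructor
  · intro r a b hab ha hb
    rcases eq_or_ne r 0 with rfl | hr
    · exact T.2 a b hab ha hb
    · rw [max_lt_max_iff_boxMax T ⟨_, mem_belowFirstRow_of_mem_skewCells ha hr⟩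
        ⟨_, mem_belowFirstRow_of_mem_skewCells hb hr⟩]
      exact hrow _ _ rfl hab
  · intro c a b hab ha hb
    have hb' := mem_belowFirstRow_of_mem_skewCells hb (Nat.ne_zero_of_lt hab)
    rcases eq_or_ne a 0 with rfl | hr
    · have h1 := column_lt_card_belowFirstRow hb'
      have h2 := (Finset.mem_filter.1 ha).2 rfl
      have h3 := card_parts_le T.1.content
      simp only at h1 h2
      omega
    · rw [max_lt_max_iff_boxMax T ⟨_, mem_belowFirstRow_of_mem_skewCells ha hr⟩ ⟨_, hb'⟩]
      exact hcol _ _ rfl hab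

/-- If `g` reversed two boxes of a column, then `T` and `T ∘ g` would order the same two entries in
opposite ways. So `g` is monotone on each column. -/
theorem eq_one_of_columnsIncrease {T : SPTBar lam k} {g : BoxPerm lam} (hg : g ∈ columnGroup lam)
    (hT : ColumnsIncrease T) (hTg : ColumnsIncrease (permute T g)) : g = 1 := by
  rw [mem_columnGroup] at hg
  refine perm_eq_one_of_monotone (fun c => c.1.2) (fun c => c.1.1) (fun a b => box_ext) g hg ?_
  intro a b hab hr
  have h1 := hTg a b hab hr
  rw [boxMax_permute, boxMax_permute] at h1
  by_contra hlt
  have hab' : (g b).1.2 = (g a).1.2 := by rw [hg, hg]; exact hab.symm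
  rcases (not_lt.1 hlt).lt_or_eq with h | h
  · exact lt_asymm h1 (hT _ _ hab' h)
  · rw [box_ext hab' h] at h1
    exact lt_irrefl _ h1

theorem eq_one_of_rowsIncrease {T : SPTBar lam k} {g : BoxPerm lam} (hg : g ∈ rowGroup lam)
    (hT : RowsIncrease T) (hTg : RowsIncrease (permute T g)) : g = 1 := by
  rw [mem_rowGroup] at hg
  refine perm_eq_one_of_monotone (fun c => c.1.1) (fun c => c.1.2)
    (fun a b h h' => box_ext h' h) g hg ?_
  intro a b hab hr
  have h1 := hTg a b hab hr
  rw [boxMax_permute, boxMax_permute] at h1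
  by_contra hlt
  have hab' : (g b).1.1 = (g a).1.1 := by rw [hg, hg]; exact hab.symm
  rcases (not_lt.1 hlt).lt_or_eq with h | h
  · exact lt_asymm h1 (hT _ _ hab' h)
  · rw [box_ext h hab'] at h1
    exact lt_irrefl _ h1

end Permute

/-! ### Linear independence by triangularity -/

section LinearIndependence

variable {lam : YoungDiagram} {k : ℕ}

/-- The sum of the maxima of the propagating blocks, weighted with their rows. -/
def rowWeight (T : SPTBar lam k) : ℤ := ∑ c, (c.1.1 : ℤ) * boxMax T c

theorem rowWeight_permute_of_mem_rowGroup (T : SPTBar lam k) {h : BoxPerm lam}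
    (hh : h ∈ rowGroup lam) : rowWeight (permute T h) = rowWeight T := by
  rw [rowWeight, rowWeight, ← Equiv.sum_comp h fun c => (c.1.1 : ℤ) * boxMax T c]
  exact Finset.sum_congr rfl fun c _ => by rw [boxMax_permute, mem_rowGroup.1 hh]

/-- By the exchange argument a column permutation that maximizes the weight makes the columns
increase. Since those of `T` increase already, the identity is the only maximizer. -/
theorem rowWeight_permute_lt {T : SPTBar lam k} (hT : ColumnsIncrease T) {g : BoxPerm lam}
    (hg : g ∈ columnGroup lam) (hg1 : g ≠ 1) : rowWeight (permute T g) < rowWeight T := by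
  have key : ∀ σ : BoxPerm lam, σ ∈ columnGroup lam →
      (∀ τ ∈ columnGroup lam, rowWeight (permute T τ) ≤ rowWeight (permute T σ)) → σ = 1 := by
    intro σ hσ hmax
    refine eq_one_of_columnsIncrease hσ hT fun c c' hc hr => ?_
    rw [boxMax_permute, boxMax_permute]
    refine increasing_of_sum_max (p := fun c => c.1.2) (r := fun c => c.1.1)
      (boxMax_injective T) (s := Set.univ)
      (mem_columnGroup.1 hσ) (fun a ha => absurd (Set.mem_univ a) ha) (fun τ hτ _ => ?_)
      c c' (Set.mem_univ _) (Set.mem_univ _) hc hr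
    simpa only [rowWeight, boxMax_permute] using hmax τ (mem_columnGroup.2 hτ)
  obtain ⟨σ, hσ, hmax⟩ := (columnGroup lam).exists_max_image (fun σ => rowWeight (permute T σ))
    ⟨1, one_mem_columnGroup⟩
  obtain rfl := key σ hσ hmax
  rw [permute_one] at hmax
  refine lt_of_le_of_ne (hmax g hg) fun h => hg1 (key g hg fun τ hτ => ?_)
  rw [h]
  exact hmax τ hτ

theorem youngVector_apply (T U : SPTBar lam k)
    [∀ g, Decidable (permute T g = U)] :
    youngVector T U = ∑ g ∈ columnGroup lam, ∑ h ∈ rowGroup lam,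
      if permute T (g * h) = U then ((Equiv.Perm.sign g : ℤ) : ℂ) else 0 := by
  classical
  simp only [youngVector, Finsupp.finsetSum_apply, Finsupp.smul_apply, Finsupp.single_apply,
    smul_eq_mul, mul_ite, mul_one, mul_zero]

/-- A permutation that preserves all rows and all columns is trivial, so `γρ = 1` only for `γ = ρ =
1`. -/
theorem youngVector_self {T : SPTBar lam k} : youngVector T T = 1 := by
  classical
  have h1 : ∀ g ∈ columnGroup lam, ∀ h ∈ rowGroup lam, permute T (g * h) = T → g = 1 ∧ h = 1 := by
    intro g hg h hh hT
    have h2 : g * h = 1 := permute_injective T (hT.trans (permute_one T).symm)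
    have h3 : h = 1 := by
      refine Equiv.ext fun c => box_ext ?_ (mem_rowGroup.1 hh c)
      rw [eq_inv_of_mul_eq_one_right h2]
      exact mem_columnGroup.1 (inv_mem_columnGroup hg) c
    subst h3
    exact ⟨by simpa using h2, rfl⟩
  rw [youngVector_apply, Finset.sum_eq_single 1, Finset.sum_eq_single 1]
  · simp [permute_one]
  · intro h hh hne
    rw [if_neg fun hT => hne (h1 1 one_mem_columnGroup h hh hT).2]
  · exact fun h => absurd one_mem_rowGroup h
  · intro g hg hne
    exact Finset.sum_eq_zero fun h hh => if_neg fun hT => hne (h1 g hg h hh hT).1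
  · exact fun h => absurd one_mem_columnGroup h

/-- Write `U = (T ∘ g) ∘ ρ`. The row permutation `ρ` does not change the weight, so a strict drop
occurs unless `g = 1`. In that case `U` and `T` are row-increasing rearrangements of each other
along rows, hence equal. -/
theorem eq_or_rowWeight_lt_of_youngVector_ne_zero {T U : SPTBar lam k} (hT : T.1.IsStandard)
    (hU : U.1.IsStandard) (h : youngVector T U ≠ 0) : T = U ∨ rowWeight U < rowWeight T := by
  classical
  rw [youngVector_apply] at h
  obtain ⟨g, hg, h⟩ := Finset.exists_ne_zero_of_sum_ne_zero h
  obtain ⟨ρ, hρ, h⟩ := Finset.exists_ne_zero_of_sum_ne_zero h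
  have hTU : permute T (g * ρ) = U := by
    by_contra hne
    exact h (if_neg hne)
  subst hTU
  by_cases hg1 : g = 1
  · subst hg1
    rw [one_mul] at hU ⊢
    rw [eq_one_of_rowsIncrease hρ (rowsIncrease_of_isStandard hT) (rowsIncrease_of_isStandard hU),
      permute_one]
    exact Or.inl rfl
  · rw [← permute_permute, rowWeight_permute_of_mem_rowGroup _ hρ]
    exact Or.inr (rowWeight_permute_lt (columnsIncrease_of_isStandard hT) hg hg1)

theorem linearIndependent_natVec :
    LinearIndependent ℂ (fun T : SSPT lam k => natVec T.1) := by
  classical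
  refine LinearIndependent.of_comp (naturalModule lam k).subtype ?_
  rw [linearIndependent_iff']
  intro s a ha
  by_contra! hne
  obtain ⟨T₀, hT₀, ha₀⟩ := hne
  -- The coefficient at a tableau `T` of maximal weight among those with nonzero coefficient
  -- isolates `a T`: any other `N_U` that contains `[T]` has `rowWeight T < rowWeight U`.
  obtain ⟨T, hT, hmax⟩ := (s.filter fun T => a T ≠ 0).exists_max_image (fun T => rowWeight T.1)
    ⟨T₀, Finset.mem_filter.2 ⟨hT₀, ha₀⟩⟩
  rw [Finset.mem_filter] at hT
  have h1 := congrArg (fun v : SPTBar lam k →₀ ℂ => v T.1) ha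
  simp only [Function.comp_apply, Submodule.subtype_apply, natVec, Finsupp.finsetSum_apply,
    Finsupp.smul_apply, smul_eq_mul, Finsupp.zero_apply] at h1
  rw [Finset.sum_eq_single_of_mem T hT.1, youngVector_self, mul_one] at h1
  · exact hT.2 h1
  · intro U hU hUT
    by_cases haU : a U = 0
    · rw [haU, zero_mul]
    · rw [mul_eq_zero_iff_left haU]
      by_contra hne
      rcases eq_or_rowWeight_lt_of_youngVector_ne_zero U.2 T.2 hne with h | h
      · exact hUT (Subtype.ext h)
      · exact not_lt_of_ge (hmax U (Finset.mem_filter.2 ⟨hU, haU⟩)) h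

end LinearIndependence

/-! ### The vectors `N_T` satisfy the Garnir relations -/

section GarnirVanishing

variable {lam : YoungDiagram} {k : ℕ}

theorem sign_mul_cast (g h : BoxPerm lam) :
    ((Equiv.Perm.sign (g * h) : ℤ) : ℂ) =
      ((Equiv.Perm.sign g : ℤ) : ℂ) * ((Equiv.Perm.sign h : ℤ) : ℂ) := by
  rw [Equiv.Perm.sign_mul, Units.val_mul, Int.cast_mul]

theorem sign_cast_mul_self (g : BoxPerm lam) :
    ((Equiv.Perm.sign g : ℤ) : ℂ) * ((Equiv.Perm.sign g : ℤ) : ℂ) = 1 := by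
  rw [← Int.cast_mul, ← Units.val_mul, Int.units_mul_self, Units.val_one, Int.cast_one]

theorem youngVector_permute_of_mem_columnGroup (T : SPTBar lam k) {h : BoxPerm lam}
    (hh : h ∈ columnGroup lam) :
    youngVector (permute T h) = ((Equiv.Perm.sign h : ℤ) : ℂ) • youngVector T := by
  simp only [youngVector, Finset.smul_sum]
  refine Finset.sum_nbij' (fun g => h * g) (fun g => h⁻¹ * g)
    (fun g hg => mul_mem_columnGroup hh hg)
    (fun g hg => mul_mem_columnGroup (inv_mem_columnGroup hh) hg) (fun g _ => by simp)
    (fun g _ => by simp) fun g _ => Finset.sum_congr rfl fun ρ _ => ?_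
  rw [permute_permute, smul_smul, sign_mul_cast, ← mul_assoc ((Equiv.Perm.sign h : ℤ) : ℂ),
    sign_cast_mul_self, one_mul, mul_assoc]

open Classical in
/-- The permutations of the boxes of a Garnir belt. -/
noncomputable def beltGroup (lam : YoungDiagram) (r j : ℕ) : Finset (BoxPerm lam) :=
  Finset.univ.filter fun g => ∀ c, ¬ InBelt r j c.1 → g c = c

open Classical in
/-- The permutations of the boxes of a Garnir belt that preserve both of its columns. -/
noncomputable def beltColumnGroup (lam : YoungDiagram) (r j : ℕ) : Finset (BoxPerm lam) :=
  (beltGroup lam r j).filter fun g => g ∈ columnGroup lam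

theorem mem_beltGroup {r j : ℕ} {g : BoxPerm lam} :
    g ∈ beltGroup lam r j ↔ ∀ c, ¬ InBelt r j c.1 → g c = c := by
  simp [beltGroup]

theorem mem_beltColumnGroup {r j : ℕ} {g : BoxPerm lam} :
    g ∈ beltColumnGroup lam r j ↔ g ∈ beltGroup lam r j ∧ g ∈ columnGroup lam := by
  simp [beltColumnGroup]

theorem mul_mem_beltGroup {r j : ℕ} {g h : BoxPerm lam} (hg : g ∈ beltGroup lam r j)
    (hh : h ∈ beltGroup lam r j) : g * h ∈ beltGroup lam r j := by
  rw [mem_beltGroup] at *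
  intro c hc
  rw [Equiv.Perm.mul_apply, hh c hc, hg c hc]

theorem inv_mem_beltGroup {r j : ℕ} {g : BoxPerm lam} (hg : g ∈ beltGroup lam r j) :
    g⁻¹ ∈ beltGroup lam r j := by
  rw [mem_beltGroup] at *
  intro c hc
  rw [Equiv.Perm.inv_eq_iff_eq, hg c hc]

theorem inBelt_apply {r j : ℕ} {g : BoxPerm lam} (hg : g ∈ beltGroup lam r j)
    {c : {c : ℕ × ℕ // c ∈ belowFirstRow lam}} (hc : InBelt r j c.1) : InBelt r j (g c).1 := by
  by_contra h
  have := g.injective (mem_beltGroup.1 hg _ h)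
  rw [this] at h
  exact h hc

/-- The position of a box when the boxes are read down the columns, from left to right. -/
def readingOrder (c : {c : ℕ × ℕ // c ∈ belowFirstRow lam}) : ℕ :=
  c.1.2 * lam.colLen 0 + c.1.1

theorem row_lt_colLen (c : {c : ℕ × ℕ // c ∈ belowFirstRow lam}) : c.1.1 < lam.colLen 0 := by
  rw [← YoungDiagram.mem_iff_lt_colLen]
  exact lam.up_left_mem le_rfl (Nat.zero_le _) (mem_belowFirstRow.1 c.2).1

/-- Every row index is smaller than `lam.colLen 0`, so the reading order is the lexicographic order
on (column, row). -/
theorem readingOrder_lt_iff {c c' : {c : ℕ × ℕ // c ∈ belowFirstRow lam}} :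
    readingOrder c < readingOrder c' ↔
      c.1.2 < c'.1.2 ∨ (c.1.2 = c'.1.2 ∧ c.1.1 < c'.1.1) := by
  have h1 := row_lt_colLen c
  have h2 := row_lt_colLen c'
  unfold readingOrder
  rcases lt_trichotomy c.1.2 c'.1.2 with h | h | h
  · have := Nat.mul_le_mul_right (lam.colLen 0) (Nat.succ_le_of_lt h)
    rw [Nat.succ_mul] at this
    constructor <;> intro <;> omega
  · rw [h]
    constructor <;> intro <;> omega
  · have := Nat.mul_le_mul_right (lam.colLen 0) (Nat.succ_le_of_lt h)
    rw [Nat.succ_mul] at this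
    constructor <;> intro <;> omega

theorem readingOrder_injective :
    Function.Injective (readingOrder : {c : ℕ × ℕ // c ∈ belowFirstRow lam} → ℕ) := by
  intro c c' h
  have h1 := mt readingOrder_lt_iff.2 h.not_lt
  have h2 := mt readingOrder_lt_iff.2 h.not_gt
  exact box_ext (by omega) (by omega)

theorem isGarnirRep_iff {r j : ℕ} {g : BoxPerm lam} : IsGarnirRep r j g ↔
    g ∈ beltGroup lam r j ∧ ∀ c c' : {c : ℕ × ℕ // c ∈ belowFirstRow lam}, InBelt r j c.1 →
      InBelt r j c'.1 → c.1.2 = c'.1.2 → c.1.1 < c'.1.1 →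
        readingOrder (g c) < readingOrder (g c') := by
  simp only [IsGarnirRep, mem_beltGroup, readingOrder_lt_iff]

/-- Uniqueness of the representative in a coset. Both `g` and `g * u` are increasing on each belt
column, which forces `u` to be monotone there. The mixed cases, with one box outside the belt, hold
because `u` preserves the belt and each belt column is an upper or a lower part of its column. -/
theorem eq_one_of_isGarnirRep_mul {r j : ℕ} {g u : BoxPerm lam} (hg : IsGarnirRep r j g)
    (hu : u ∈ beltColumnGroup lam r j) (hgu : IsGarnirRep r j (g * u)) : u = 1 := by
  rw [isGarnirRep_iff] at hg hgu
  obtain ⟨hu1, hu2⟩ := mem_beltColumnGroup.1 hu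
  have hcol := mem_columnGroup.1 hu2
  refine perm_eq_one_of_monotone (fun c => c.1.2) (fun c => c.1.1) (fun a b => box_ext) u hcol ?_
  intro a b hab hr
  have hab' : (u a).1.2 = (u b).1.2 := by rw [hcol, hcol]; exact hab
  by_cases ha : InBelt r j a.1
  · by_cases hb : InBelt r j b.1
    · have h1 := hgu.2 a b ha hb hab hr
      rw [Equiv.Perm.mul_apply, Equiv.Perm.mul_apply] at h1
      by_contra hlt
      rcases (not_lt.1 hlt).lt_or_eq with h | h
      · exact lt_asymm h1 (hg.2 _ _ (inBelt_apply hu1 hb) (inBelt_apply hu1 ha) hab'.symm h)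
      · rw [box_ext hab' h.symm] at h1
        exact lt_irrefl _ h1
    · have h1 := inBelt_apply hu1 ha
      have h2 := hcol a
      rw [mem_beltGroup.1 hu1 b hb]
      unfold InBelt at *
      omega
  · rw [mem_beltGroup.1 hu1 a ha]
    by_cases hb : InBelt r j b.1
    · have h1 := inBelt_apply hu1 hb
      have h2 := hcol b
      unfold InBelt at *
      omega
    · rwa [mem_beltGroup.1 hu1 b hb]

theorem isGarnirRep_one (r j : ℕ) : IsGarnirRep r j (1 : BoxPerm lam) :=
  ⟨fun _ _ => rfl, fun _ _ _ _ h1 h2 => Or.inr ⟨h1, h2⟩⟩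

open Classical in
/-- Every permutation of a Garnir belt is the product of a unique representative and a unique
permutation that preserves both columns. -/
theorem sum_beltGroup {M : Type*} [AddCommMonoid M] (r j : ℕ) (F : BoxPerm lam → M) :
    ∑ κ ∈ beltGroup lam r j, F κ =
      ∑ h ∈ beltColumnGroup lam r j,
        ∑ g ∈ Finset.univ.filter (fun g : BoxPerm lam => IsGarnirRep r j g), F (g * h) := by
  rw [← Finset.sum_product']
  symm
  refine Finset.sum_nbij (fun x => x.2 * x.1) ?_ ?_ ?_ fun _ _ => rfl
  · rintro ⟨h, g⟩ hx
    rw [Finset.mem_product, Finset.mem_filter, isGarnirRep_iff] at hx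
    exact mul_mem_beltGroup hx.2.2.1 (mem_beltColumnGroup.1 hx.1).1
  · rintro ⟨h, g⟩ hx ⟨h', g'⟩ hx' (heq : g * h = g' * h')
    rw [Finset.mem_coe, Finset.mem_product, Finset.mem_filter, mem_beltColumnGroup] at hx hx'
    have hg : g = g' * (h' * h⁻¹) := by rw [← mul_assoc, ← heq, mul_inv_cancel_right]
    have hu : h' * h⁻¹ = 1 := by
      refine eq_one_of_isGarnirRep_mul hx'.2.2 (mem_beltColumnGroup.2 ⟨?_, ?_⟩)
        (hg ▸ hx.2.2)
      · exact mul_mem_beltGroup hx'.1.1 (inv_mem_beltGroup hx.1.1)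
      · exact mul_mem_columnGroup hx'.1.2 (inv_mem_columnGroup hx.1.2)
    rw [hu, mul_one] at hg
    rw [hg, mul_inv_eq_one.1 hu]
  · intro κ hκ
    rw [Finset.mem_coe] at hκ
    -- Existence of the representative: sort the reading positions of the images under `κ` within
    -- each belt column. Then `κ * σ` is the representative and `σ⁻¹` the column part.
    obtain ⟨σ, hσ1, hσ2, hσ3⟩ := exists_sorting_perm (fun c => c.1.2) (fun c => c.1.1)
      (fun c => readingOrder (κ c)) (readingOrder_injective.comp κ.injective)
      {c : {c : ℕ × ℕ // c ∈ belowFirstRow lam} | InBelt r j c.1}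
    have hσ : σ ∈ beltGroup lam r j := mem_beltGroup.2 hσ2
    refine ⟨(σ⁻¹, κ * σ), ?_, by simp⟩
    rw [Finset.mem_coe, Finset.mem_product, Finset.mem_filter, isGarnirRep_iff,
      mem_beltColumnGroup]
    exact ⟨⟨inv_mem_beltGroup hσ, inv_mem_columnGroup (mem_columnGroup.2 hσ1)⟩,
      Finset.mem_univ _, mul_mem_beltGroup hκ hσ, hσ3⟩

theorem mem_belowFirstRow_of_le {x y j j' : ℕ} (h : (x, j) ∈ belowFirstRow lam) (hy : y ≤ x)
    (hj : j' ≤ j) (hy0 : y ≠ 0) : (y, j') ∈ belowFirstRow lam := by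
  rw [mem_belowFirstRow] at *
  exact ⟨lam.up_left_mem hy hj h.1, hy0⟩

/-- A column permutation moves some pair of boxes of a row into the two columns of a Garnir belt. -/
theorem exists_same_row {r j : ℕ} (hrj : (r, j + 1) ∈ belowFirstRow lam) {γ : BoxPerm lam}
    (hγ : γ ∈ columnGroup lam) :
    ∃ a b : {c : ℕ × ℕ // c ∈ belowFirstRow lam}, a ≠ b ∧ InBelt r j a.1 ∧ InBelt r j b.1 ∧
      (γ⁻¹ a).1.1 = (γ⁻¹ b).1.1 := by
  have hG : ∀ σ ∈ columnGroup lam, ∀ x i, (x, i) ∈ belowFirstRow lam →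
      ∃ y, Equiv.Perm.ofSubtype σ (x, i) = (y, i) ∧ (y, i) ∈ belowFirstRow lam := by
    intro σ hσ x i h
    rw [Equiv.Perm.ofSubtype_apply_of_mem σ h]
    have h1 : (σ ⟨(x, i), h⟩).1 = ((σ ⟨(x, i), h⟩).1.1, i) :=
      Prod.ext rfl (mem_columnGroup.1 hσ _)
    exact ⟨_, h1, h1 ▸ (σ ⟨(x, i), h⟩).2⟩
  set G := Equiv.Perm.ofSubtype γ with hGdef
  set G' := Equiv.Perm.ofSubtype γ⁻¹ with hG'def
  have hGinj : Function.Injective G := G.injective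
  have hG'inj : Function.Injective G' := G'.injective
  have hr0 : r ≠ 0 := (mem_belowFirstRow.1 hrj).2
  have hx : ∀ x ∈ Finset.Icc 1 r, ∃ y z, G' (x, j + 1) = (y, j + 1) ∧ G (y, j) = (z, j) ∧
      (y, j) ∈ belowFirstRow lam ∧ (z, j) ∈ belowFirstRow lam := by
    -- The map studied is `x ↦ z`: pull the box `(x, j + 1)` back by `γ` to row `y`, step left to
    -- `(y, j)`, and push forward to `(z, j)`. Then `(z, j)` and `(x, j + 1)` come from the same row
    -- `y`.
    intro x hx
    rw [Finset.mem_Icc] at hx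
    obtain ⟨y, hy, hy'⟩ := hG _ (inv_mem_columnGroup hγ) x (j + 1)
      (mem_belowFirstRow_of_le hrj hx.2 le_rfl (by omega))
    have hyj := mem_belowFirstRow_of_le hy' le_rfl j.le_succ (mem_belowFirstRow.1 hy').2
    obtain ⟨z, hz, hz'⟩ := hG _ hγ y j hyj
    exact ⟨y, z, hy, hz, hyj, hz'⟩
  obtain ⟨x, hxr, y, z, hy, hz, hyj, hzj, hzr⟩ : ∃ x ∈ Finset.Icc 1 r, ∃ y z,
      G' (x, j + 1) = (y, j + 1) ∧ G (y, j) = (z, j) ∧ (y, j) ∈ belowFirstRow lam ∧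
        (z, j) ∈ belowFirstRow lam ∧ r ≤ z := by
    by_contra! hcon
    -- Pigeonhole: `x ↦ z` is injective on the `r` rows `1, …, r`, so it cannot take all its values
    -- in `1, …, r - 1`. Rows of `lam*` start at 1 because row 0 is the first row of `lam`.
    obtain ⟨x, hx1, x', hx2, hne, heq⟩ := Finset.exists_ne_map_eq_of_card_lt_of_maps_to
      (s := Finset.Icc 1 r) (t := Finset.Ico 1 r) (by simp; omega)
      (f := fun x => (G ((G' (x, j + 1)).1, j)).1) (by
        intro x hx'
        obtain ⟨y, z, h1, h2, h3, h4⟩ := hx x hx'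
        have h5 := hcon x hx' y z h1 h2 h3 h4
        have h6 := (mem_belowFirstRow.1 h4).2
        simp only [h1, h2, Finset.coe_Ico, Set.mem_Ico]
        simp only at h6
        omega)
    obtain ⟨y, z, h1, h2, -⟩ := hx x hx1
    obtain ⟨y', z', h1', h2', -⟩ := hx x' hx2
    simp only [h1, h2, h1', h2'] at heq
    subst heq
    have h3 := (Prod.mk.inj (hGinj (h2.trans h2'.symm))).1
    subst h3
    exact hne (Prod.mk.inj (hG'inj (h1.trans h1'.symm))).1
  rw [Finset.mem_Icc] at hxr
  have hxj := mem_belowFirstRow_of_le (y := x) hrj hxr.2 le_rfl (by omega)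
  refine ⟨⟨(z, j), hzj⟩, ⟨(x, j + 1), hxj⟩, ?_, Or.inl ⟨rfl, hzr⟩, Or.inr ⟨rfl, hxr.2⟩, ?_⟩
  · intro h
    have := (Prod.mk.inj (Subtype.mk.inj h)).2
    omega
  · rw [hGdef, Equiv.Perm.ofSubtype_apply_of_mem γ hyj] at hz
    rw [hG'def, Equiv.Perm.ofSubtype_apply_of_mem γ⁻¹ hxj] at hy
    rw [hy, ← (Subtype.ext hz : γ ⟨(y, j), hyj⟩ = ⟨(z, j), hzj⟩)]
    simp

/-- Let `τ` exchange the two belt boxes whose preimages under `γ` share a row. Then `τ' = γ⁻¹ τ γ`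
is a row permutation and `κ γ ρ = (κ τ) γ (τ' ρ)`. So the substitution `(κ, ρ) ↦ (κ τ, τ' ρ)` keeps
each tableau and changes each sign, and the sum equals its own negative. -/
theorem sum_beltGroup_rowGroup_eq_zero {r j : ℕ} (hrj : (r, j + 1) ∈ belowFirstRow lam)
    {γ : BoxPerm lam} (hγ : γ ∈ columnGroup lam) (T : SPTBar lam k) :
    ∑ κ ∈ beltGroup lam r j, ∑ ρ ∈ rowGroup lam,
      ((Equiv.Perm.sign κ : ℤ) : ℂ) • Finsupp.single (permute T (κ * γ * ρ)) (1 : ℂ) = 0 := by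
  obtain ⟨a, b, hab, ha, hb, hrow⟩ := exists_same_row hrj hγ
  set τ := Equiv.swap a b with hτ
  set τ' := Equiv.swap (γ⁻¹ a) (γ⁻¹ b) with hτ'
  have hτ1 : τ * τ = 1 := Equiv.swap_mul_self a b
  have hτ1' : τ' * τ' = 1 := Equiv.swap_mul_self _ _
  have hττ' : τ * γ * τ' = γ := by
    have h : γ * τ' = τ * γ := by
      rw [hτ', Equiv.mul_swap_eq_swap_mul]
      simp [hτ]
    rw [mul_assoc, h, ← mul_assoc, hτ1, one_mul]
  have hτb : τ ∈ beltGroup lam r j := by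
    refine mem_beltGroup.2 fun c hc => Equiv.swap_apply_of_ne_of_ne ?_ ?_
    · rintro rfl; exact hc ha
    · rintro rfl; exact hc hb
  have hτr : τ' ∈ rowGroup lam := by
    refine mem_rowGroup.2 fun c => ?_
    by_cases h1 : c = γ⁻¹ a
    · rw [hτ', h1, Equiv.swap_apply_left, hrow]
    · by_cases h2 : c = γ⁻¹ b
      · rw [hτ', h2, Equiv.swap_apply_right, hrow]
      · rw [hτ', Equiv.swap_apply_of_ne_of_ne h1 h2]
  rw [← self_eq_neg, ← Finset.sum_neg_distrib]
  refine Finset.sum_nbij' (fun κ => κ * τ) (fun κ => κ * τ)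
    (fun κ hκ => mul_mem_beltGroup hκ hτb) (fun κ hκ => mul_mem_beltGroup hκ hτb)
    (fun κ _ => by simp only [mul_assoc, hτ1, mul_one])
    (fun κ _ => by simp only [mul_assoc, hτ1, mul_one]) fun κ _ => ?_
  rw [← Finset.sum_neg_distrib]
  refine Finset.sum_nbij' (fun ρ => τ' * ρ) (fun ρ => τ' * ρ)
    (fun ρ hρ => mul_mem_rowGroup hτr hρ) (fun ρ hρ => mul_mem_rowGroup hτr hρ)
    (fun ρ _ => by simp only [← mul_assoc, hτ1', one_mul])
    (fun ρ _ => by simp only [← mul_assoc, hτ1', one_mul]) fun ρ _ => ?_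
  have h1 : κ * τ * γ * (τ' * ρ) = κ * γ * ρ := by
    rw [← mul_assoc, mul_assoc κ, mul_assoc κ, hττ']
  rw [h1, sign_mul_cast, hτ, Equiv.Perm.sign_swap hab]
  simp

-- The vanishing sum over the whole belt group is the sum over representatives taken once for each
-- element of the belt column group, since the column factor contributes its sign twice. The order
-- of that group is nonzero in `ℂ`, so it can be cancelled.
open Classical in
theorem garnir_sum_youngVector (T : SPTBar lam k) {r j : ℕ}
    (hrj : (r, j + 1) ∈ belowFirstRow lam) :
    ∑ g ∈ Finset.univ.filter (fun g : BoxPerm lam => IsGarnirRep r j g),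
      ((Equiv.Perm.sign g : ℤ) : ℂ) • youngVector (permute T g) = 0 := by
  have h1 : ∑ κ ∈ beltGroup lam r j,
      ((Equiv.Perm.sign κ : ℤ) : ℂ) • youngVector (permute T κ) = 0 := by
    simp only [youngVector, Finset.smul_sum, permute_permute]
    rw [Finset.sum_comm]
    refine Finset.sum_eq_zero fun γ hγ => ?_
    rw [← smul_zero ((Equiv.Perm.sign γ : ℤ) : ℂ), ← sum_beltGroup_rowGroup_eq_zero hrj hγ T]
    simp only [Finset.smul_sum, ← mul_assoc]
    exact Finset.sum_congr rfl fun κ _ => Finset.sum_congr rfl fun ρ _ => smul_comm _ _ _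
  rw [sum_beltGroup] at h1
  have h2 : ∀ h ∈ beltColumnGroup lam r j,
      ∑ g ∈ Finset.univ.filter (fun g : BoxPerm lam => IsGarnirRep r j g),
        ((Equiv.Perm.sign (g * h) : ℤ) : ℂ) • youngVector (permute T (g * h)) =
      ∑ g ∈ Finset.univ.filter (fun g : BoxPerm lam => IsGarnirRep r j g),
        ((Equiv.Perm.sign g : ℤ) : ℂ) • youngVector (permute T g) := by
    intro h hh
    refine Finset.sum_congr rfl fun g _ => ?_
    rw [← permute_permute,
      youngVector_permute_of_mem_columnGroup _ (mem_beltColumnGroup.1 hh).2, smul_smul,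
      sign_mul_cast, mul_assoc, sign_cast_mul_self, mul_one]
  rw [Finset.sum_congr rfl h2, Finset.sum_const, smul_eq_zero] at h1
  refine h1.resolve_left fun h0 => ?_
  rw [Finset.card_eq_zero] at h0
  have : (1 : BoxPerm lam) ∈ beltColumnGroup lam r j :=
    mem_beltColumnGroup.2 ⟨mem_beltGroup.2 fun _ _ => rfl, one_mem_columnGroup⟩
  rw [h0] at this
  exact absurd this (Finset.notMem_empty _)

theorem coe_zsmul_natVec (a : ℤ) (T : SPTBar lam k) :
    ((a • natVec T : naturalModule lam k) : SPTBar lam k →₀ ℂ) = (a : ℂ) • youngVector T := by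
  rw [Int.cast_smul_eq_zsmul]
  rfl

/-- The linear map `[T] ↦ N_T`. -/
noncomputable def natVecMap (lam : YoungDiagram) (k : ℕ) :
    (SPTBar lam k →₀ ℤ) →ₗ[ℤ] naturalModule lam k :=
  Finsupp.linearCombination ℤ natVec

theorem natVecMap_single (T : SPTBar lam k) (a : ℤ) :
    natVecMap lam k (Finsupp.single T a) = a • natVec T :=
  Finsupp.linearCombination_single ℤ a T

/-- This transfers every congruence among formal symbols to an identity among the vectors `N_T`. -/
theorem garnirRelations_le_ker : garnirRelations lam k ≤ LinearMap.ker (natVecMap lam k) := by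
  refine Submodule.span_le.2 ?_
  rintro v (⟨T, g, hg, rfl⟩ | ⟨T, r, j, hrj, rfl⟩)
  · rw [SetLike.mem_coe, LinearMap.mem_ker, map_sub, natVecMap_single, natVecMap_single, one_smul,
      sub_eq_zero]
    refine Subtype.ext ?_
    rw [coe_zsmul_natVec]
    exact youngVector_permute_of_mem_columnGroup T hg
  · rw [SetLike.mem_coe, LinearMap.mem_ker, map_sum]
    refine Subtype.ext ?_
    rw [Submodule.coe_zero, ← garnir_sum_youngVector T hrj, Submodule.coe_sum]
    refine Finset.sum_congr rfl fun g _ => ?_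
    rw [natVecMap_single, coe_zsmul_natVec]

end GarnirVanishing

/-! ### Straightening by Garnir relations, and spanning -/

section Straightening

variable {lam : YoungDiagram} {k : ℕ}

/-- The sum of the maxima of the propagating blocks, weighted with their columns. -/
def columnWeight (T : SPTBar lam k) : ℤ := ∑ c, (c.1.2 : ℤ) * boxMax T c

theorem columnWeight_permute (T : SPTBar lam k) (g : BoxPerm lam) :
    columnWeight (permute T g) = ∑ c, ((g⁻¹ c).1.2 : ℤ) * boxMax T c := by
  rw [columnWeight, ← Equiv.sum_comp g fun c => ((g⁻¹ c).1.2 : ℤ) * boxMax T c]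
  exact Finset.sum_congr rfl fun c _ => by rw [boxMax_permute]; simp

theorem columnWeight_permute_of_mem_columnGroup (T : SPTBar lam k) {g : BoxPerm lam}
    (hg : g ∈ columnGroup lam) : columnWeight (permute T g) = columnWeight T := by
  rw [columnWeight_permute, columnWeight]
  exact Finset.sum_congr rfl fun c _ => by rw [mem_columnGroup.1 (inv_mem_columnGroup hg)]

theorem columnWeight_le (T : SPTBar lam k) :
    columnWeight T ≤ ∑ c : {c : ℕ × ℕ // c ∈ belowFirstRow lam}, (c.1.2 : ℤ) * k :=
  Finset.sum_le_sum fun c _ =>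
    mul_le_mul_of_nonneg_left (Int.ofNat_le.2 (boxMax_le T c)) (Int.natCast_nonneg _)

/-- The change of weight is the sum of column shift times entry. As the shifts add up to zero, each
entry may be replaced by its difference from the threshold `m`. Entries `≥ m` lie in the left belt
column and can only move right, entries `< m` lie in the right one and can only move left, so no
term is negative. -/
theorem columnWeight_lt_permute {T : SPTBar lam k} {r j m : ℕ} {g : BoxPerm lam}
    (hg : IsGarnirRep r j g) (hg1 : g ≠ 1)
    (hA : ∀ c, InBelt r j c.1 → c.1.2 = j → m ≤ boxMax T c)
    (hB : ∀ c, InBelt r j c.1 → c.1.2 = j + 1 → boxMax T c < m) :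
    columnWeight T < columnWeight (permute T g) := by
  have hgb := (isGarnirRep_iff.1 hg).1
  have hinv : ∀ c, InBelt r j c.1 → InBelt r j (g⁻¹ c).1 :=
    fun c hc => inBelt_apply (inv_mem_beltGroup hgb) hc
  have hout := mem_beltGroup.1 (inv_mem_beltGroup hgb)
  have hcol : ∀ c : {c : ℕ × ℕ // c ∈ belowFirstRow lam}, InBelt r j c.1 →
      c.1.2 = j ∨ c.1.2 = j + 1 := by
    rintro c (h | h)
    · exact Or.inl h.1
    · exact Or.inr h.1
  have hzero : ∑ c, (((g⁻¹ c).1.2 : ℤ) - c.1.2) = 0 := by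
    rw [Finset.sum_sub_distrib, Equiv.sum_comp g⁻¹ fun c => (c.1.2 : ℤ), sub_self]
  have hnonneg : ∀ c, 0 ≤ (((g⁻¹ c).1.2 : ℤ) - c.1.2) * (boxMax T c - m) := by
    intro c
    by_cases hc : InBelt r j c.1
    · have h1 := hcol _ (hinv c hc)
      rcases hcol c hc with h | h
      · exact mul_nonneg (by omega) (by have := hA c hc h; omega)
      · exact mul_nonneg_of_nonpos_of_nonpos (by omega) (by have := hB c hc h; omega)
    · rw [hout c hc, sub_self, zero_mul]
  have hex : ∃ c, 0 < (((g⁻¹ c).1.2 : ℤ) - c.1.2) * (boxMax T c - m) := by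
    -- If no term is positive, no box of the right belt column moves left. All shifts are then
    -- nonnegative with sum zero, so `g` preserves the columns, and the only such representative is
    -- the identity.
    by_contra! hle
    have h1 : ∀ c, 0 ≤ ((g⁻¹ c).1.2 : ℤ) - c.1.2 := by
      intro c
      by_cases hc : InBelt r j c.1
      · rcases hcol c hc with h | h
        · have := hcol _ (hinv c hc)
          omega
        · by_contra hlt
          have := hB c hc h
          exact absurd (hle c) (not_le.2 (mul_pos_of_neg_of_neg (not_le.1 hlt) (by omega)))
      · rw [hout c hc, sub_self]
    have h2 : g⁻¹ ∈ columnGroup lam := mem_columnGroup.2 fun c => by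
      have := (Finset.sum_eq_zero_iff_of_nonneg fun c _ => h1 c).1 hzero c (Finset.mem_univ _)
      omega
    refine hg1 (eq_one_of_isGarnirRep_mul (isGarnirRep_one r j) (mem_beltColumnGroup.2
      ⟨hgb, ?_⟩) (by rwa [one_mul]))
    simpa using inv_mem_columnGroup h2
  have hpos : 0 < ∑ c, (((g⁻¹ c).1.2 : ℤ) - c.1.2) * (boxMax T c - m) :=
    Finset.sum_pos' (fun c _ => hnonneg c) (hex.imp fun c hc => ⟨Finset.mem_univ _, hc⟩)
  have hsplit : ∑ c, (((g⁻¹ c).1.2 : ℤ) - c.1.2) * (boxMax T c - m) =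
      (columnWeight (permute T g) - columnWeight T) -
        (∑ c, (((g⁻¹ c).1.2 : ℤ) - c.1.2)) * m := by
    rw [columnWeight_permute, columnWeight, ← Finset.sum_sub_distrib, Finset.sum_mul,
      ← Finset.sum_sub_distrib]
    exact Finset.sum_congr rfl fun c _ => by ring
  rw [hsplit, hzero] at hpos
  linarith

theorem rowsIncrease_of_adjacent {T : SPTBar lam k}
    (h : ∀ r j (hc : (r, j) ∈ belowFirstRow lam) (hc' : (r, j + 1) ∈ belowFirstRow lam),
      boxMax T ⟨(r, j), hc⟩ < boxMax T ⟨(r, j + 1), hc'⟩) : RowsIncrease T := by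
  have key : ∀ r a d (hc : (r, a) ∈ belowFirstRow lam)
      (hc' : (r, a + (d + 1)) ∈ belowFirstRow lam),
      boxMax T ⟨(r, a), hc⟩ < boxMax T ⟨(r, a + (d + 1)), hc'⟩ := by
    intro r a d hc
    induction d with
    | zero => exact h r a hc
    | succ d ih =>
      intro hc'
      have hd := mem_belowFirstRow_of_le (j' := a + (d + 1)) hc' le_rfl (by omega)
        (mem_belowFirstRow.1 hc').2
      exact (ih hd).trans (h r _ hd hc')
  rintro ⟨⟨r, a⟩, hc⟩ ⟨⟨r', b⟩, hc'⟩ (rfl : r = r') (hab : a < b)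
  obtain ⟨d, rfl⟩ : ∃ d, b = a + (d + 1) := ⟨b - a - 1, by omega⟩
  exact key r a d hc hc'

theorem ColumnsIncrease.boxMax_le {T : SPTBar lam k} (hT : ColumnsIncrease T)
    {c c' : {c : ℕ × ℕ // c ∈ belowFirstRow lam}} (hcol : c.1.2 = c'.1.2)
    (hrow : c.1.1 ≤ c'.1.1) : boxMax T c ≤ boxMax T c' := by
  rcases hrow.lt_or_eq with h | h
  · exact (hT _ _ hcol h).le
  · rw [box_ext hcol h]

/-- The span of the symbols of the standard tableaux. -/
noncomputable def standardSpan (lam : YoungDiagram) (k : ℕ) : Submodule ℤ (SPTBar lam k →₀ ℤ) :=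
  Submodule.span ℤ (Set.range fun U : SSPT lam k => Finsupp.single U.1 (1 : ℤ))

/-- Induction on the gap between the column weight and its upper bound. Sorting the columns costs
only a sign and keeps the weight; the Garnir relation at a descent then leads to tableaux of larger
weight. -/
theorem single_mem_sup (hn : 2 * k ≤ lam.card) (hlam : (belowFirstRow lam).card ≤ k)
    (S : SPTBar lam k) :
    Finsupp.single S (1 : ℤ) ∈ garnirRelations lam k ⊔ standardSpan lam k := by
  classical
  generalize hN : ((∑ c : {c : ℕ × ℕ // c ∈ belowFirstRow lam}, (c.1.2 : ℤ) * k) -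
    columnWeight S).toNat = N
  induction N using Nat.strong_induction_on generalizing S with
  | _ N ih =>
  obtain ⟨γ, hγ, -, hsort⟩ := exists_sorting_perm (fun c => c.1.2) (fun c => c.1.1)
    (boxMax S) (boxMax_injective S) Set.univ
  replace hγ : γ ∈ columnGroup lam := mem_columnGroup.2 hγ
  have hT : ColumnsIncrease (permute S γ) := fun c c' h1 h2 => by
    rw [boxMax_permute, boxMax_permute]
    exact hsort c c' (Set.mem_univ _) (Set.mem_univ _) h1 h2
  have hwT := columnWeight_permute_of_mem_columnGroup S hγ
  have hγrel : Finsupp.single (permute S γ) (1 : ℤ) -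
      Finsupp.single S (Equiv.Perm.sign γ : ℤ) ∈ garnirRelations lam k :=
    Submodule.subset_span (Or.inl ⟨S, γ, hγ, rfl⟩)
  set T := permute S γ
  suffices hmem : Finsupp.single T (1 : ℤ) ∈ garnirRelations lam k ⊔ standardSpan lam k by
    have h1 : Finsupp.single S (Equiv.Perm.sign γ : ℤ) ∈
        garnirRelations lam k ⊔ standardSpan lam k := by
      rw [← sub_sub_cancel (Finsupp.single T (1 : ℤ)) (Finsupp.single S _)]
      exact Submodule.sub_mem _ hmem (Submodule.mem_sup_left hγrel)
    have h2 := Submodule.smul_mem _ (Equiv.Perm.sign γ : ℤ) h1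
    rwa [Finsupp.smul_single, smul_eq_mul, ← Units.val_mul, Int.units_mul_self,
      Units.val_one] at h2
  by_cases hrows : RowsIncrease T
  · exact Submodule.mem_sup_right
      (Submodule.subset_span ⟨⟨T, isStandard_of_increase hn hlam hT hrows⟩, rfl⟩)
  · obtain ⟨r, j, hc, hc', hlt⟩ : ∃ r j, ∃ (hc : (r, j) ∈ belowFirstRow lam)
        (hc' : (r, j + 1) ∈ belowFirstRow lam),
        boxMax T ⟨(r, j + 1), hc'⟩ < boxMax T ⟨(r, j), hc⟩ := by
      by_contra! hcon
      refine hrows (rowsIncrease_of_adjacent fun r j hc hc' => ?_)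
      refine lt_of_le_of_ne (hcon r j hc hc') fun h => ?_
      have := (Prod.mk.inj (Subtype.mk.inj (boxMax_injective T h))).2
      omega
    have hrel : ∑ g ∈ Finset.univ.filter (fun g : BoxPerm lam => IsGarnirRep r j g),
        Finsupp.single (permute T g) (Equiv.Perm.sign g : ℤ) ∈ garnirRelations lam k :=
      Submodule.subset_span (Or.inr ⟨T, r, j, hc', by convert rfl⟩)
    -- The identity representative contributes `[T]` itself; the remaining terms are covered by the
    -- induction hypothesis.
    rw [← Finset.add_sum_erase _ _ (Finset.mem_filter.2 ⟨Finset.mem_univ (1 : BoxPerm lam),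
      isGarnirRep_one r j⟩), permute_one, Equiv.Perm.sign_one, Units.val_one] at hrel
    refine (Submodule.add_mem_iff_left _ ?_).1 (Submodule.mem_sup_left hrel)
    refine Submodule.sum_mem _ fun g hg => ?_
    rw [Finset.mem_erase, Finset.mem_filter] at hg
    have hlt' : columnWeight T < columnWeight (permute T g) := by
      -- The threshold is the entry at `(r, j)`. Column `j` increases downwards, so its belt boxes
      -- have entries at least this large. Those of column `j + 1` are at most the entry at `(r, j +
      -- 1)`, which is smaller by the descent.
      refine columnWeight_lt_permute (m := boxMax T ⟨(r, j), hc⟩) hg.2.2 hg.1 ?_ ?_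
      · intro c hcb hcj
        refine hT.boxMax_le hcj.symm ?_
        rcases hcb with h | h
        · exact h.2
        · omega
      · intro c hcb hcj
        refine lt_of_le_of_lt (hT.boxMax_le hcj ?_) hlt
        rcases hcb with h | h
        · omega
        · exact h.2
    have h1 := ih _ (by have := columnWeight_le (permute T g); omega) (permute T g) rfl
    have h2 := Submodule.smul_mem _ (Equiv.Perm.sign g : ℤ) h1
    rwa [Finsupp.smul_single, smul_eq_mul, mul_one] at h2

theorem straightens (hn : 2 * k ≤ lam.card) (hlam : (belowFirstRow lam).card ≤ k)
    (S : SPTBar lam k) : Straightens S := by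
  obtain ⟨v, hv, w, hw, hvw⟩ := Submodule.mem_sup.1 (single_mem_sup hn hlam S)
  obtain ⟨c, rfl⟩ := (Finsupp.mem_span_range_iff_exists_finsupp).1 hw
  have hw' : (c.sum fun U a => a • Finsupp.single U.1 (1 : ℤ)) =
      c.sum fun U a => Finsupp.single U.1 a :=
    Finsupp.sum_congr fun U _ => by rw [Finsupp.smul_single, smul_eq_mul, mul_one]
  rw [hw'] at hvw
  have hmem : Finsupp.single S 1 - c.sum (fun U a => Finsupp.single U.1 a) ∈
      garnirRelations lam k := by
    rw [← hvw, add_sub_cancel_right]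
    exact hv
  refine ⟨c, ?_, hmem⟩
  have h1 := LinearMap.mem_ker.1 (garnirRelations_le_ker hmem)
  rw [map_sub, natVecMap_single, one_smul, sub_eq_zero, Finsupp.sum, map_sum] at h1
  rw [h1]
  exact Finset.sum_congr rfl fun U _ => natVecMap_single _ _

theorem span_natVec (hn : 2 * k ≤ lam.card) (hlam : (belowFirstRow lam).card ≤ k) :
    Submodule.span ℂ (Set.range fun T : SSPT lam k => natVec T.1) = ⊤ := by
  have hmem : ∀ S : SPTBar lam k,
      natVec S ∈ Submodule.span ℂ (Set.range fun T : SSPT lam k => natVec T.1) := by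
    intro S
    obtain ⟨c, hc, -⟩ := straightens hn hlam S
    rw [hc]
    refine Submodule.sum_mem _ fun U _ => ?_
    have h : c U • natVec U.1 = (c U : ℂ) • natVec U.1 := Subtype.ext (coe_zsmul_natVec _ _)
    change c U • natVec U.1 ∈ _
    rw [h]
    exact Submodule.smul_mem _ _ (Submodule.subset_span ⟨U, rfl⟩)
  -- The generators of the module, viewed as elements of the module, span all of it.
  have htop : Submodule.span ℂ
      (Subtype.val ⁻¹' Set.range youngVector : Set (naturalModule lam k)) = ⊤ :=
    Submodule.span_span_coe_preimage
  rw [eq_top_iff, ← htop]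
  refine Submodule.span_le.2 ?_
  rintro x ⟨S, hS⟩
  rw [show x = natVec S from Subtype.ext hS.symm]
  exact hmem S

end Straightening

/-! ### Construction of the tableau `d(T)` -/

section Images

variable {lam : YoungDiagram} {k : ℕ}

theorem rowLen_zero_add_card_belowFirstRow :
    lam.rowLen 0 + (belowFirstRow lam).card = lam.card := by
  rw [YoungDiagram.rowLen_eq_card]
  exact Finset.card_filter_add_card_filter_not fun c : ℕ × ℕ => c.1 = 0

/-- The first row of `lam` has length `n - |lam*|`, so `N = t - |lam*|` of its boxes remain,
starting at column `n - t`. -/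
theorem mem_skewCells_iff {t N : ℕ} (ht : t ≤ lam.card) (hN : N + (belowFirstRow lam).card = t)
    {c : ℕ × ℕ} :
    c ∈ skewCells lam t ↔ c ∈ belowFirstRow lam ∨ ∃ i : Fin N, c = (0, lam.card - t + i) := by
  have hlen := rowLen_zero_add_card_belowFirstRow (lam := lam)
  constructor
  · intro hc
    by_cases h0 : c.1 = 0
    · obtain ⟨r, a⟩ := c
      obtain rfl : r = 0 := h0
      simp only [skewCells, Finset.mem_filter, YoungDiagram.mem_cells,
        YoungDiagram.mem_iff_lt_rowLen] at hc
      have := hc.2 trivial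
      exact Or.inr ⟨⟨a - (lam.card - t), by omega⟩, Prod.ext rfl (by simp only; omega)⟩
    · exact Or.inl (mem_belowFirstRow_of_mem_skewCells hc h0)
  · rintro (hc | ⟨i, rfl⟩)
    · exact belowFirstRow_subset_skewCells t hc
    · simp only [skewCells, Finset.mem_filter, YoungDiagram.mem_cells,
        YoungDiagram.mem_iff_lt_rowLen]
      exact ⟨by omega, fun _ => by omega⟩

/-- The entries below the first row can be prescribed: the other blocks fill the first row in
increasing order. -/
theorem exists_tableau (p : Finpartition (Finset.univ : Finset (Fin k)))
    (hp : p.parts.card ≤ lam.card) (f : ℕ × ℕ → Finset (Fin k))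
    (hf : ∀ c ∈ belowFirstRow lam, f c ∈ p.parts) (hinj : Set.InjOn f (belowFirstRow lam)) :
    ∃ S : SPTBar lam k, S.1.content = p ∧ ∀ c ∈ belowFirstRow lam, S.1.entry c = f c := by
  classical
  set R := p.parts \ (belowFirstRow lam).image f with hR
  have himg : (belowFirstRow lam).image f ⊆ p.parts := Finset.image_subset_iff.2 hf
  have hRcard : R.card + (belowFirstRow lam).card = p.parts.card := by
    rw [hR, ← Finset.card_image_of_injOn hinj, Finset.card_sdiff_add_card_eq_card himg]
  have hRp : ∀ B ∈ R, B ∈ p.parts := fun B hB => (Finset.mem_sdiff.1 hB).1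
  -- Distinct blocks have distinct maxima. Enumerating the maxima of the remaining blocks in
  -- increasing order therefore enumerates the blocks for the first row.
  have hM : (R.image Finset.max).card = R.card := Finset.card_image_of_injOn
    fun B hB B' hB' h => eq_of_max_eq p (hRp B hB) (hRp B' hB') h
  set e := (R.image Finset.max).orderEmbOfFin hM
  have he : ∀ i, ∃ B ∈ R, B.max = e i := fun i =>
    Finset.mem_image.1 (Finset.orderEmbOfFin_mem _ hM i)
  choose B hBR hBe using he
  have hBsurj : ∀ X ∈ R, ∃ i, B i = X := by
    intro X hX
    have h1 : X.max ∈ Set.range e := by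
      rw [Finset.range_orderEmbOfFin]
      exact Finset.mem_coe.2 (Finset.mem_image_of_mem _ hX)
    obtain ⟨i, hi⟩ := h1
    exact ⟨i, eq_of_max_eq p (hRp _ (hBR i)) (hRp _ hX) ((hBe i).trans hi)⟩
  have hBinj : Function.Injective B := fun i i' h =>
    e.injective (by rw [← hBe, ← hBe, h])
  set m := lam.card - p.parts.card
  let entry : ℕ × ℕ → Finset (Fin k) := fun c =>
    if c ∈ belowFirstRow lam then f c
    else if h : ∃ i : Fin R.card, c = (0, m + i) then B h.choose else ∅
  have hbelow : ∀ c ∈ belowFirstRow lam, entry c = f c := fun c hc => if_pos hc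
  have hnot : ∀ a, ((0, a) : ℕ × ℕ) ∉ belowFirstRow lam := fun a h =>
    (mem_belowFirstRow.1 h).2 rfl
  have hfirst : ∀ i : Fin R.card, entry (0, m + i) = B i := by
    intro i
    have h : ∃ i' : Fin R.card, ((0, m + i) : ℕ × ℕ) = (0, m + i') := ⟨i, rfl⟩
    have hi : h.choose = i := by
      have := (Prod.mk.inj h.choose_spec).2
      exact Fin.ext (by omega)
    change (if _ then _ else _) = _
    rw [if_neg (hnot _), dif_pos h, hi]
  have hcells := fun c => mem_skewCells_iff (c := c) hp hRcard
  have hdisj : ∀ c ∈ belowFirstRow lam, ∀ i, f c ≠ B i := fun c hc i h =>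
    (Finset.mem_sdiff.1 (hBR i)).2 (h ▸ Finset.mem_image_of_mem f hc)
  refine ⟨⟨⟨p, entry, ⟨?_, ?_, ?_⟩, ?_⟩, ?_⟩, rfl, hbelow⟩
  · intro c hc
    rcases (hcells c).1 hc with h | ⟨i, rfl⟩
    · rw [hbelow c h]
      exact hf c h
    · rw [hfirst]
      exact hRp _ (hBR i)
  · intro c hc c' hc' heq
    rcases (hcells c).1 hc with h | ⟨i, rfl⟩ <;> rcases (hcells c').1 hc' with h' | ⟨i', rfl⟩
    · rw [hbelow c h, hbelow c' h'] at heq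
      exact hinj h h' heq
    · rw [hbelow c h, hfirst] at heq
      exact absurd heq (hdisj c h i')
    · rw [hbelow c' h', hfirst] at heq
      exact absurd heq.symm (hdisj c' h' i)
    · rw [hfirst, hfirst] at heq
      rw [hBinj heq]
  · intro X hX
    by_cases h : X ∈ (belowFirstRow lam).image f
    · obtain ⟨c, hc, rfl⟩ := Finset.mem_image.1 h
      exact ⟨c, (hcells c).2 (Or.inl hc), hbelow c hc⟩
    · obtain ⟨i, rfl⟩ := hBsurj X (Finset.mem_sdiff.2 ⟨hX, h⟩)
      exact ⟨_, (hcells _).2 (Or.inr ⟨i, rfl⟩), hfirst i⟩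
  · intro c hc
    rw [hcells, not_or] at hc
    change (if _ then _ else _) = _
    rw [if_neg hc.1, dif_neg hc.2]
  · intro a b hab ha hb
    rcases (hcells _).1 ha with h | ⟨i, hi⟩
    · exact absurd h (hnot a)
    rcases (hcells _).1 hb with h | ⟨i', hi'⟩
    · exact absurd h (hnot b)
    have hi2 := (Prod.mk.inj hi).2
    have hi2' := (Prod.mk.inj hi').2
    change (entry (0, a)).max < (entry (0, b)).max
    rw [hi, hi', hfirst, hfirst, hBe, hBe]
    exact e.strictMono (Fin.lt_def.2 (by omega))

theorem stack_of_part_eq {d : Diagram k} {π : Finpartition (Finset.univ : Finset (Fin k))}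
    {x y : Fin k} (h : π.part x = π.part y) : stack d π (Sum.inr x) (Sum.inr y) :=
  Relation.EqvGen.rel _ _ (Or.inr ⟨x, y, rfl, rfl, h⟩)

theorem stack_of_rel {d : Diagram k} {π : Finpartition (Finset.univ : Finset (Fin k))}
    {a b : Fin k ⊕ Fin k} (h : d a b) : stack d π a b :=
  Relation.EqvGen.rel _ _ (Or.inl h)

/-- The upper bound in each computation of components: a label constant on the blocks of `d` and of
`π` is constant on connected components. -/
theorem stack_le_ker {γ : Type*} {d : Diagram k}
    {π : Finpartition (Finset.univ : Finset (Fin k))} (F : Fin k ⊕ Fin k → γ)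
    (hd : ∀ a b, d a b → F a = F b)
    (hπ : ∀ x y, π.part x = π.part y → F (Sum.inr x) = F (Sum.inr y)) {a b : Fin k ⊕ Fin k}
    (h : stack d π a b) : F a = F b := by
  have hle : stack d π ≤ Setoid.ker F := by
    refine Setoid.eqvGen_le ?_
    rintro a b (h | ⟨x, y, rfl, rfl, h⟩)
    · exact hd a b h
    · exact hπ x y h
  exact hle h

theorem mem_connectedTop {d : Diagram k} {π : Finpartition (Finset.univ : Finset (Fin k))}
    {B : Finset (Fin k)} {x : Fin k} :
    x ∈ connectedTop d π B ↔ ∃ y ∈ B, stack d π (Sum.inl x) (Sum.inr y) := by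
  simp [connectedTop]

theorem part_eq_part_iff (p : Finpartition (Finset.univ : Finset (Fin k))) {x y : Fin k} :
    p.part x = p.part y ↔ x ∈ p.part y :=
  (p.mem_part_iff_part_eq_part (Finset.mem_univ _) (Finset.mem_univ _)).symm

/-- A nonempty `connectedTop` of a block is an entire block of `top (d ∘ π)`. So the prescribed
entries are blocks, distinct by `h2`, and the first row takes the others. There is room because the
content has at most `k ≤ n` blocks. -/
theorem exists_isImage (hk : k ≤ lam.card) {d : Diagram k} {T : SPTBar lam k}
    (h1 : ∀ c ∈ belowFirstRow lam, (connectedTop d T.1.content (T.1.entry c)).Nonempty)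
    (h2 : Set.InjOn (fun c => connectedTop d T.1.content (T.1.entry c)) (belowFirstRow lam)) :
    ∃ S, IsImage d T S := by
  classical
  set p := Finpartition.ofSetoid (topRow d T.1.content) with hp
  have hpart : ∀ x y, y ∈ p.part x ↔ topRow d T.1.content x y := fun x y =>
    Finpartition.mem_part_ofSetoid_iff_rel
  have hf : ∀ c ∈ belowFirstRow lam, connectedTop d T.1.content (T.1.entry c) ∈ p.parts := by
    intro c hc
    obtain ⟨x, hx⟩ := h1 c hc
    have : connectedTop d T.1.content (T.1.entry c) = p.part x := by
      ext z
      rw [hpart]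
      rw [mem_connectedTop] at hx ⊢
      obtain ⟨y, hy, hxy⟩ := hx
      constructor
      · rintro ⟨y', hy', hzy'⟩
        have hyy' : T.1.content.part y = T.1.content.part y' := by
          rw [T.1.content.part_eq_of_mem (entry_mem_parts T hc) hy,
            T.1.content.part_eq_of_mem (entry_mem_parts T hc) hy']
        exact (stack d _).trans' hxy ((stack d _).trans' (stack_of_part_eq hyy')
          ((stack d _).symm' hzy'))
      · intro hxz
        exact ⟨y, hy, (stack d _).trans' ((stack d _).symm' hxz) hxy⟩
    rw [this]
    exact p.part_mem.2 (Finset.mem_univ x)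
  obtain ⟨S, hS, hS'⟩ := exists_tableau p ((card_parts_le p).trans hk)
    (fun c => connectedTop d T.1.content (T.1.entry c)) hf h2
  refine ⟨S, ?_, hS'⟩
  rw [hS]
  ext x y
  rw [Setoid.ker_def, eq_comm, part_eq_part_iff, hpart]

theorem propagating_eq (T : SPTBar lam k) :
    T.1.propagating = (belowFirstRow lam).image T.1.entry := by
  refine congrArg (fun s => Finset.image T.1.entry s) (Finset.ext fun c => ?_)
  rw [Finset.mem_filter]
  exact ⟨fun h => mem_belowFirstRow_of_mem_skewCells h.1 h.2,
    fun h => ⟨belowFirstRow_subset_skewCells _ h, (mem_belowFirstRow.1 h).2⟩⟩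

theorem mem_propagating {T : SPTBar lam k} {B : Finset (Fin k)} :
    B ∈ T.1.propagating ↔ ∃ c ∈ belowFirstRow lam, T.1.entry c = B := by
  rw [propagating_eq, Finset.mem_image]

theorem mem_nonpropagating {T : SPTBar lam k} {B : Finset (Fin k)} :
    B ∈ T.1.nonpropagating ↔ B ∈ T.1.content.parts ∧ B ∉ T.1.propagating := by
  simp only [SetPartitionTableau.nonpropagating, SetPartitionTableau.propagating,
    Finset.mem_image, Finset.mem_filter]
  constructor
  · rintro ⟨c, ⟨hc, h0⟩, rfl⟩
    refine ⟨T.1.bijOn.mapsTo hc, ?_⟩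
    rintro ⟨c', ⟨hc', h0'⟩, heq⟩
    rw [T.1.bijOn.injOn hc' hc heq] at h0'
    exact h0' h0
  · rintro ⟨hB, hne⟩
    obtain ⟨c, hc, rfl⟩ := T.1.bijOn.surjOn hB
    refine ⟨c, ⟨hc, ?_⟩, rfl⟩
    by_contra h0
    exact hne ⟨c, ⟨hc, h0⟩, rfl⟩

theorem mem_parts_of_mem_propagating {T : SPTBar lam k} {B : Finset (Fin k)}
    (h : B ∈ T.1.propagating) : B ∈ T.1.content.parts := by
  obtain ⟨c, hc, rfl⟩ := mem_propagating.1 h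
  exact entry_mem_parts T hc

/-- This gives uniqueness in the combinatorial descriptions `IsSwap`, `IsIsolate` and `IsJoin`, each
of which fixes exactly these data. -/
theorem eq_of_entry_eq_of_nonpropagating_eq {S S' : SPTBar lam k}
    (h1 : ∀ c ∈ belowFirstRow lam, S.1.entry c = S'.1.entry c)
    (h2 : S.1.nonpropagating = S'.1.nonpropagating) : S = S' := by
  have hparts : ∀ U : SPTBar lam k, U.1.content.parts =
      U.1.propagating ∪ U.1.nonpropagating := by
    intro U
    ext B
    rw [Finset.mem_union, mem_nonpropagating]
    have := @mem_parts_of_mem_propagating _ _ U B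
    tauto
  refine SPTBar_ext S S' (Finpartition.ext ?_) h1
  rw [hparts, hparts, h2, propagating_eq, propagating_eq]
  exact congrArg (fun s => s ∪ _) (Finset.image_congr h1)

theorem IsImage.mem_part {d : Diagram k} {T S : SPTBar lam k} (h : IsImage d T S) {x y : Fin k} :
    y ∈ S.1.content.part x ↔ topRow d T.1.content y x := by
  rw [← part_eq_part_iff, ← h.1, Setoid.ker_def]

theorem mem_parts_iff (p : Finpartition (Finset.univ : Finset (Fin k))) {B : Finset (Fin k)} :
    B ∈ p.parts ↔ ∃ x, p.part x = B := by
  constructor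
  · intro hB
    obtain ⟨x, hx⟩ := p.nonempty_of_mem_parts hB
    exact ⟨x, p.part_eq_of_mem hB hx⟩
  · rintro ⟨x, rfl⟩
    exact p.part_mem.2 (Finset.mem_univ x)

theorem removed_eq_zero {d : Diagram k} {π : Finpartition (Finset.univ : Finset (Fin k))}
    (h : ∀ y, ∃ x, stack d π (Sum.inl x) (Sum.inr y)) : removed d π = 0 := by
  rw [removed]
  refine (congrArg Set.ncard ?_).trans (Set.ncard_empty (Set (Fin k ⊕ Fin k)))
  rw [Set.eq_empty_iff_forall_notMem]
  rintro _ ⟨⟨a, rfl⟩, hC⟩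
  rcases a with x | y
  · exact hC x ((stack d π).refl' _)
  · obtain ⟨x, hx⟩ := h y
    exact hC x hx

theorem act_eq_of_removed_eq_zero {d : Diagram k} {T S : SPTBar lam k} (hS : IsImage d T S)
    (h : removed d T.1.content = 0) : act d (natVec T) = natVec S := by
  rw [(act_natVec d T).1 S hS, h, pow_zero, one_smul]

end Images

/-! ### The generators `𝔰ᵢ` -/

section SwapGenerator

variable {lam : YoungDiagram} {k : ℕ} (i j : Fin k)

/-- Each top vertex is joined by an edge to one bottom vertex, so a component is labelled by the
block of `π` that it meets. -/
theorem stack_swap_iff (π : Finpartition (Finset.univ : Finset (Fin k))) (a b : Fin k ⊕ Fin k) :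
    stack (swapDiagram i j) π a b ↔
      π.part (Sum.elim (Equiv.swap i j) id a) = π.part (Sum.elim (Equiv.swap i j) id b) := by
  have hd : ∀ a b, swapDiagram i j a b →
      Sum.elim (Equiv.swap i j) id a = Sum.elim (Equiv.swap i j) id b := by
    rintro (x | x) (y | y) h <;>
      simp only [Setoid.ker_def, Sum.elim_inl, Sum.elim_inr, id_eq] at h ⊢
    · rw [h]
    · rw [h, Equiv.swap_apply_self]
    · rw [← h, Equiv.swap_apply_self]
    · exact (Equiv.swap i j).injective h
  have hbot : ∀ a, stack (swapDiagram i j) π a (Sum.inr (Sum.elim (Equiv.swap i j) id a)) := by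
    rintro (x | y)
    · refine stack_of_rel ?_
      simp [Setoid.ker_def]
    · exact Setoid.refl' _ _
  constructor
  · exact stack_le_ker (fun a => π.part (Sum.elim (Equiv.swap i j) id a))
      (fun a b h => congrArg _ (hd a b h)) fun x y h => h
  · intro h
    exact Setoid.trans' _ (hbot a) (Setoid.trans' _ (stack_of_part_eq h) (Setoid.symm' _ (hbot b)))

theorem removed_swap (π : Finpartition (Finset.univ : Finset (Fin k))) :
    removed (swapDiagram i j) π = 0 :=
  removed_eq_zero fun y => ⟨Equiv.swap i j y, by simp [stack_swap_iff]⟩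

theorem mem_image_swap {B : Finset (Fin k)} {x : Fin k} :
    x ∈ B.image (Equiv.swap i j) ↔ Equiv.swap i j x ∈ B := by
  rw [Finset.mem_image]
  constructor
  · rintro ⟨y, hy, rfl⟩
    rwa [Equiv.swap_apply_self]
  · exact fun h => ⟨_, h, Equiv.swap_apply_self _ _ _⟩

theorem connectedTop_swap (T : SPTBar lam k) {c : ℕ × ℕ} (hc : c ∈ belowFirstRow lam) :
    connectedTop (swapDiagram i j) T.1.content (T.1.entry c) =
      (T.1.entry c).image (Equiv.swap i j) := by
  ext x
  rw [mem_connectedTop, mem_image_swap]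
  simp only [stack_swap_iff, Sum.elim_inl, Sum.elim_inr, id_eq]
  constructor
  · rintro ⟨y, hy, h⟩
    rwa [part_eq_part_iff, T.1.content.part_eq_of_mem (entry_mem_parts T hc) hy] at h
  · exact fun h => ⟨_, h, rfl⟩

theorem IsImage.isSwap {T S : SPTBar lam k} (h : IsImage (swapDiagram i j) T S) :
    IsSwap i j T S := by
  have hbelow : ∀ c ∈ belowFirstRow lam,
      S.1.entry c = (T.1.entry c).image (Equiv.swap i j) :=
    fun c hc => (h.2 c hc).trans (connectedTop_swap i j T hc)
  have hpart : ∀ x, S.1.content.part x =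
      (T.1.content.part (Equiv.swap i j x)).image (Equiv.swap i j) := by
    intro x
    ext y
    rw [h.mem_part, mem_image_swap, ← part_eq_part_iff]
    exact stack_swap_iff i j T.1.content (Sum.inl y) (Sum.inl x)
  have hinj : Function.Injective fun B : Finset (Fin k) => B.image (Equiv.swap i j) :=
    Finset.image_injective (Equiv.injective _)
  refine ⟨hbelow, ?_⟩
  ext X
  simp only [mem_nonpropagating, Finset.mem_image, mem_propagating]
  constructor
  · rintro ⟨hX, hne⟩
    obtain ⟨x, rfl⟩ := (mem_parts_iff _).1 hX
    refine ⟨_, ⟨T.1.content.part_mem.2 (Finset.mem_univ (Equiv.swap i j x)), ?_⟩, (hpart x).symm⟩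
    rintro ⟨c, hc, hcx⟩
    exact hne ⟨c, hc, by rw [hbelow c hc, hcx, hpart]⟩
  · rintro ⟨Y, ⟨hY, hne⟩, rfl⟩
    refine ⟨?_, ?_⟩
    · obtain ⟨x, rfl⟩ := (mem_parts_iff _).1 hY
      exact (mem_parts_iff _).2 ⟨Equiv.swap i j x, by rw [hpart, Equiv.swap_apply_self]⟩
    · rintro ⟨c, hc, hcY⟩
      rw [hbelow c hc] at hcY
      exact hne ⟨c, hc, hinj hcY⟩

theorem exists_swap (hk : k ≤ lam.card) (T : SPTBar lam k) :
    ∃ S : SPTBar lam k, (∀ S' : SPTBar lam k, IsSwap i j T S' ↔ S' = S) ∧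
      act (swapDiagram i j) (natVec T) = natVec S := by
  obtain ⟨S, hS⟩ : ∃ S, IsImage (swapDiagram i j) T S := by
    refine exists_isImage hk (fun c hc => ?_) fun c hc c' hc' heq => ?_
    · rw [connectedTop_swap i j T hc]
      exact (T.1.content.nonempty_of_mem_parts (entry_mem_parts T hc)).image _
    · dsimp only at heq
      rw [connectedTop_swap i j T hc, connectedTop_swap i j T hc'] at heq
      have h := entry_injective T (a₁ := ⟨c, hc⟩) (a₂ := ⟨c', hc'⟩)
        (Finset.image_injective (Equiv.injective _) heq)
      exact congrArg Subtype.val h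
  have hswap := hS.isSwap
  refine ⟨S, fun S' => ⟨fun h => ?_, fun h => h ▸ hswap⟩,
    act_eq_of_removed_eq_zero hS (removed_swap i j _)⟩
  exact eq_of_entry_eq_of_nonpropagating_eq
    (fun c hc => (h.1 c hc).trans (hswap.1 c hc).symm) (h.2.trans hswap.2.symm)

end SwapGenerator

/-! ### The generators `𝔭ᵢ` -/

section IsolateGenerator

variable {lam : YoungDiagram} {k : ℕ} (i : Fin k)

/-- The component of a vertex when `𝔭ᵢ` is stacked on a set partition; the top vertex `i` is
isolated. -/
def isolateComponent (π : Finpartition (Finset.univ : Finset (Fin k))) :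
    Fin k ⊕ Fin k → Option (Finset (Fin k)) :=
  Sum.elim (fun x => if x = i then none else some (π.part x)) fun y => some (π.part y)

theorem stack_isolate_iff (π : Finpartition (Finset.univ : Finset (Fin k)))
    (a b : Fin k ⊕ Fin k) :
    stack (isolateDiagram i) π a b ↔ isolateComponent i π a = isolateComponent i π b := by
  have hd : ∀ a b, isolateDiagram i a b → isolateComponent i π a = isolateComponent i π b := by
    rintro (x | x) (y | y) h <;>
      simp only [Setoid.ker_def, Sum.elim_inl, Sum.elim_inr, Prod.mk.injEq] at h <;>
      obtain ⟨rfl, h⟩ := h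
    · rfl
    · simp only [isolateComponent, Sum.elim_inl, Sum.elim_inr]
      rw [if_neg (by simpa using h.symm)]
    · simp only [isolateComponent, Sum.elim_inl, Sum.elim_inr]
      rw [if_neg (by simpa using h)]
    · rfl
  have hbot : ∀ x, x ≠ i → stack (isolateDiagram i) π (Sum.inl x) (Sum.inr x) := by
    intro x hx
    refine stack_of_rel ?_
    simp [Setoid.ker_def, hx]
  have hpart : ∀ x y, some (π.part x) = some (π.part y) →
      stack (isolateDiagram i) π (Sum.inr x) (Sum.inr y) := fun x y h =>
    stack_of_part_eq (Option.some_injective _ h)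
  constructor
  · exact stack_le_ker (isolateComponent i π) hd fun x y h => congrArg some h
  · intro h
    rcases a with x | x <;> rcases b with y | y <;>
      simp only [isolateComponent, Sum.elim_inl, Sum.elim_inr] at h
    · by_cases hx : x = i <;> by_cases hy : y = i
      · rw [hx, hy]
      · rw [if_pos hx, if_neg hy] at h
        exact absurd h.symm (Option.some_ne_none _)
      · rw [if_neg hx, if_pos hy] at h
        exact absurd h (Option.some_ne_none _)
      · rw [if_neg hx, if_neg hy] at h
        exact Setoid.trans' _ (hbot x hx) (Setoid.trans' _ (hpart _ _ h)
          (Setoid.symm' _ (hbot y hy)))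
    · by_cases hx : x = i
      · rw [if_pos hx] at h
        exact absurd h.symm (Option.some_ne_none _)
      · rw [if_neg hx] at h
        exact Setoid.trans' _ (hbot x hx) (hpart _ _ h)
    · by_cases hy : y = i
      · rw [if_pos hy] at h
        exact absurd h (Option.some_ne_none _)
      · rw [if_neg hy] at h
        exact Setoid.trans' _ (hpart _ _ h) (Setoid.symm' _ (hbot y hy))
    · exact hpart _ _ h

theorem stack_isolate_inl_inr {π : Finpartition (Finset.univ : Finset (Fin k))} {x y : Fin k} :
    stack (isolateDiagram i) π (Sum.inl x) (Sum.inr y) ↔ x ≠ i ∧ x ∈ π.part y := by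
  rw [stack_isolate_iff, ← part_eq_part_iff]
  simp only [isolateComponent, Sum.elim_inl, Sum.elim_inr]
  by_cases hx : x = i <;> simp [hx]

theorem topRow_isolate {π : Finpartition (Finset.univ : Finset (Fin k))} {x y : Fin k} :
    topRow (isolateDiagram i) π x y ↔ (x = i ∧ y = i) ∨ (x ≠ i ∧ y ≠ i ∧ x ∈ π.part y) := by
  rw [← part_eq_part_iff]
  refine (stack_isolate_iff i π (Sum.inl x) (Sum.inl y)).trans ?_
  simp only [isolateComponent, Sum.elim_inl]
  by_cases hx : x = i <;> by_cases hy : y = i <;> simp [hx, hy]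

theorem connectedTop_isolate (T : SPTBar lam k) {c : ℕ × ℕ} (hc : c ∈ belowFirstRow lam) :
    connectedTop (isolateDiagram i) T.1.content (T.1.entry c) = (T.1.entry c).erase i := by
  ext x
  rw [mem_connectedTop, Finset.mem_erase]
  simp only [stack_isolate_inl_inr]
  constructor
  · rintro ⟨y, hy, hx, h⟩
    rw [T.1.content.part_eq_of_mem (entry_mem_parts T hc) hy] at h
    exact ⟨hx, h⟩
  · rintro ⟨hx, h⟩
    exact ⟨x, h, hx, T.1.content.mem_part (Finset.mem_univ x)⟩

theorem erase_nonempty_of_ne {B : Finset (Fin k)} (hB : B.Nonempty) (h : B ≠ {i}) :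
    (B.erase i).Nonempty := by
  rw [Finset.nonempty_iff_ne_empty, Ne, Finset.erase_eq_empty_iff, not_or]
  exact ⟨hB.ne_empty, h⟩

/-- A block other than `{i}` keeps some element after the erasure, and this element determines the
block. -/
theorem eq_of_erase_eq (p : Finpartition (Finset.univ : Finset (Fin k))) {B B' : Finset (Fin k)}
    (hB : B ∈ p.parts) (hB' : B' ∈ p.parts) (hne : B ≠ {i}) (h : B.erase i = B'.erase i) :
    B = B' := by
  obtain ⟨x, hx⟩ := erase_nonempty_of_ne i (p.nonempty_of_mem_parts hB) hne
  exact p.eq_of_mem_parts hB hB' (Finset.mem_of_mem_erase hx) (Finset.mem_of_mem_erase (h ▸ hx))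

theorem IsImage.isIsolate {T S : SPTBar lam k} (hi : {i} ∉ T.1.content.parts)
    (h : IsImage (isolateDiagram i) T S) : IsIsolate i T S := by
  have hbelow : ∀ c ∈ belowFirstRow lam, S.1.entry c = (T.1.entry c).erase i :=
    fun c hc => (h.2 c hc).trans (connectedTop_isolate i T hc)
  have hparti : S.1.content.part i = {i} := by
    ext y
    rw [h.mem_part, topRow_isolate, Finset.mem_singleton]
    tauto
  have hpart : ∀ x, x ≠ i → S.1.content.part x = (T.1.content.part x).erase i := by
    intro x hx
    ext y
    rw [h.mem_part, topRow_isolate, Finset.mem_erase]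
    tauto
  have hne : ∀ B ∈ T.1.content.parts, B ≠ {i} := fun B hB h => hi (h ▸ hB)
  refine ⟨hbelow, ?_⟩
  ext X
  simp only [mem_nonpropagating, Finset.mem_insert, Finset.mem_image, mem_propagating]
  constructor
  · rintro ⟨hX, hnp⟩
    obtain ⟨x, rfl⟩ := (mem_parts_iff _).1 hX
    by_cases hx : x = i
    · exact Or.inl (by rw [hx, hparti])
    · refine Or.inr ⟨_, ⟨T.1.content.part_mem.2 (Finset.mem_univ x), ?_⟩, (hpart x hx).symm⟩
      rintro ⟨c, hc, hcx⟩
      exact hnp ⟨c, hc, by rw [hbelow c hc, hcx, hpart x hx]⟩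
  · rintro (rfl | ⟨Y, ⟨hY, hnp⟩, rfl⟩)
    · refine ⟨(mem_parts_iff _).2 ⟨i, hparti⟩, ?_⟩
      rintro ⟨c, hc, hci⟩
      rw [hbelow c hc] at hci
      exact Finset.notMem_erase i _ (hci ▸ Finset.mem_singleton_self i)
    · refine ⟨?_, ?_⟩
      · obtain ⟨x, hx⟩ := erase_nonempty_of_ne i (T.1.content.nonempty_of_mem_parts hY) (hne Y hY)
        rw [Finset.mem_erase] at hx
        exact (mem_parts_iff _).2 ⟨x, by rw [hpart x hx.1, T.1.content.part_eq_of_mem hY hx.2]⟩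
      · rintro ⟨c, hc, hcY⟩
        rw [hbelow c hc] at hcY
        exact hnp ⟨c, hc, eq_of_erase_eq i _ (entry_mem_parts T hc) hY
          (hne _ (entry_mem_parts T hc)) hcY⟩

theorem exists_isolate (hk : k ≤ lam.card) {T : SPTBar lam k} (hi : {i} ∉ T.1.content.parts) :
    ∃ S : SPTBar lam k, (∀ S' : SPTBar lam k, IsIsolate i T S' ↔ S' = S) ∧
      act (isolateDiagram i) (natVec T) = natVec S := by
  have hne : ∀ B ∈ T.1.content.parts, B ≠ {i} := fun B hB h => hi (h ▸ hB)
  obtain ⟨S, hS⟩ : ∃ S, IsImage (isolateDiagram i) T S := by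
    refine exists_isImage hk (fun c hc => ?_) fun c hc c' hc' heq => ?_
    · rw [connectedTop_isolate i T hc]
      exact erase_nonempty_of_ne i (T.1.content.nonempty_of_mem_parts (entry_mem_parts T hc))
        (hne _ (entry_mem_parts T hc))
    · dsimp only at heq
      rw [connectedTop_isolate i T hc, connectedTop_isolate i T hc'] at heq
      have h := entry_injective T (a₁ := ⟨c, hc⟩) (a₂ := ⟨c', hc'⟩)
        (eq_of_erase_eq i _ (entry_mem_parts T hc) (entry_mem_parts T hc')
          (hne _ (entry_mem_parts T hc)) heq)
      exact congrArg Subtype.val h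
  have hiso := hS.isIsolate i hi
  refine ⟨S, fun S' => ⟨fun h => ?_, fun h => h ▸ hiso⟩,
    act_eq_of_removed_eq_zero hS (removed_eq_zero fun y => ?_)⟩
  · exact eq_of_entry_eq_of_nonpropagating_eq
      (fun c hc => (h.1 c hc).trans (hiso.1 c hc).symm) (h.2.trans hiso.2.symm)
  · have hy := T.1.content.part_mem.2 (Finset.mem_univ y)
    obtain ⟨x, hx⟩ := erase_nonempty_of_ne i (T.1.content.nonempty_of_mem_parts hy) (hne _ hy)
    exact ⟨x, (stack_isolate_inl_inr i).2 (Finset.mem_erase.1 hx)⟩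

/-- The bottom vertex `i'` is alone in its component; any other `y'` is joined to the top vertex
`y`. -/
theorem removed_isolate {π : Finpartition (Finset.univ : Finset (Fin k))} (hi : {i} ∈ π.parts) :
    removed (isolateDiagram i) π = 1 := by
  have hparti : π.part i = {i} := π.part_eq_of_mem hi (Finset.mem_singleton_self i)
  rw [removed, Set.ncard_eq_one]
  refine ⟨{a | stack (isolateDiagram i) π a (Sum.inr i)}, Set.ext fun C => ?_⟩
  rw [Set.mem_singleton_iff]
  constructor
  · rintro ⟨⟨a, rfl⟩, hC⟩
    have key : ∀ y, (∀ x, ¬ stack (isolateDiagram i) π (Sum.inl x) (Sum.inr y)) → y = i := by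
      intro y hy
      by_contra hyi
      exact hy y ((stack_isolate_inl_inr i).2 ⟨hyi, π.mem_part (Finset.mem_univ y)⟩)
    rcases a with x | y
    · exact absurd ((stack (isolateDiagram i) π).refl' (Sum.inl x)) (hC x)
    · rw [key y hC]
  · rintro rfl
    refine ⟨⟨_, rfl⟩, fun x hx => ?_⟩
    obtain ⟨h1, h2⟩ := (stack_isolate_inl_inr i).1 hx
    rw [hparti, Finset.mem_singleton] at h2
    exact h1 h2

/-- The tableau is its own image, and the one removed component `{i'}` yields the factor `n`. -/
theorem act_isolate_nonpropagating {T : SPTBar lam k} (hi : {i} ∈ T.1.nonpropagating) :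
    act (isolateDiagram i) (natVec T) = (lam.card : ℂ) • natVec T := by
  obtain ⟨hi1, hi2⟩ := mem_nonpropagating.1 hi
  have hparti : T.1.content.part i = {i} :=
    T.1.content.part_eq_of_mem hi1 (Finset.mem_singleton_self i)
  have himage : IsImage (isolateDiagram i) T T := by
    refine ⟨?_, fun c hc => ?_⟩
    · ext x y
      rw [Setoid.ker_def, topRow_isolate, part_eq_part_iff]
      by_cases hy : y = i
      · rw [hy, hparti, Finset.mem_singleton]
        tauto
      · by_cases hx : x = i
        · have : x ∉ T.1.content.part y := by
            rw [← part_eq_part_iff, hx, eq_comm, part_eq_part_iff, hparti, Finset.mem_singleton]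
            exact hy
          tauto
        · tauto
    · rw [connectedTop_isolate i T hc, Finset.erase_eq_of_notMem]
      intro hic
      have := T.1.content.part_eq_of_mem (entry_mem_parts T hc) hic
      exact hi2 (mem_propagating.2 ⟨c, hc, this.symm.trans hparti⟩)
  rw [(act_natVec _ T).1 T himage, removed_isolate i hi1, pow_one]

/-- The propagating block `{i}` reaches no top vertex, but an entry of an image tableau cannot be
empty. -/
theorem act_isolate_propagating {T : SPTBar lam k} (hi : {i} ∈ T.1.propagating) :
    act (isolateDiagram i) (natVec T) = 0 := by
  refine (act_natVec _ T).2 ?_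
  rintro ⟨S, hS⟩
  obtain ⟨c, hc, hci⟩ := mem_propagating.1 hi
  have h := hS.2 c hc
  rw [connectedTop_isolate i T hc, hci, Finset.erase_singleton] at h
  exact S.1.content.ne_empty (entry_mem_parts S hc) h

end IsolateGenerator

/-! ### The generators `𝔟ᵢ` -/

section JoinGenerator

variable {lam : YoungDiagram} {k : ℕ} (i j : Fin k)

/-- The block of `x` after the blocks of `i` and `j` have been joined. -/
def joinedPart (π : Finpartition (Finset.univ : Finset (Fin k))) (x : Fin k) : Finset (Fin k) :=
  if π.part x = π.part i ∨ π.part x = π.part j then π.part i ∪ π.part j else π.part x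

theorem mem_joinedPart_self (π : Finpartition (Finset.univ : Finset (Fin k))) (x : Fin k) :
    x ∈ joinedPart i j π x := by
  have hx := π.mem_part (Finset.mem_univ x)
  unfold joinedPart
  split_ifs with h
  · rcases h with h | h
    · exact Finset.mem_union_left _ (h ▸ hx)
    · exact Finset.mem_union_right _ (h ▸ hx)
  · exact hx

theorem mem_joinedPart_iff {π : Finpartition (Finset.univ : Finset (Fin k))} {x y : Fin k} :
    x ∈ joinedPart i j π y ↔ joinedPart i j π x = joinedPart i j π y := by
  refine ⟨fun h => ?_, fun h => h ▸ mem_joinedPart_self i j π x⟩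
  unfold joinedPart at h ⊢
  by_cases hy : π.part y = π.part i ∨ π.part y = π.part j
  · rw [if_pos hy, Finset.mem_union, ← part_eq_part_iff, ← part_eq_part_iff] at h
    rw [if_pos hy, if_pos h]
  · rw [if_neg hy, ← part_eq_part_iff] at h
    rw [h]

/-- Every vertex is connected to the bottom vertex below it, so only bottom vertices matter. Among
them the diagram adds just the link between `i'` and `j'`, which merges the two blocks. -/
theorem stack_join_iff (π : Finpartition (Finset.univ : Finset (Fin k)))
    (a b : Fin k ⊕ Fin k) :
    stack (joinDiagram i j) π a b ↔
      joinedPart i j π (Sum.elim id id a) = joinedPart i j π (Sum.elim id id b) := by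
  have hij : joinedPart i j π i = joinedPart i j π j := by
    simp [joinedPart]
  have hq : ∀ x, joinedPart i j π (if x = j then i else x) = joinedPart i j π x := by
    intro x
    split_ifs with h
    · rw [h, hij]
    · rfl
  have hd : ∀ a b, joinDiagram i j a b →
      joinedPart i j π (Sum.elim id id a) = joinedPart i j π (Sum.elim id id b) := by
    rintro (x | x) (y | y) h <;>
      simp only [Setoid.ker_def, Sum.elim_inl, Sum.elim_inr, id_eq] at h ⊢ <;>
      rw [← hq x, ← hq y, h]
  have hbot : ∀ a, stack (joinDiagram i j) π a (Sum.inr (Sum.elim id id a)) := by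
    rintro (x | y)
    · exact stack_of_rel (by simp [Setoid.ker_def])
    · exact Setoid.refl' _ _
  have hstij : stack (joinDiagram i j) π (Sum.inr i) (Sum.inr j) :=
    stack_of_rel (by simp [Setoid.ker_def])
  have hcon : ∀ x y, joinedPart i j π x = joinedPart i j π y →
      stack (joinDiagram i j) π (Sum.inr x) (Sum.inr y) := by
    intro x y h
    have hi : ∀ z, π.part z = π.part i ∨ π.part z = π.part j →
        stack (joinDiagram i j) π (Sum.inr z) (Sum.inr i) := by
      rintro z (hz | hz)
      · exact stack_of_part_eq hz
      · exact Setoid.trans' _ (stack_of_part_eq hz) (Setoid.symm' _ hstij)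
    rw [← mem_joinedPart_iff, joinedPart] at h
    by_cases hy : π.part y = π.part i ∨ π.part y = π.part j
    · rw [if_pos hy, Finset.mem_union, ← part_eq_part_iff, ← part_eq_part_iff] at h
      exact Setoid.trans' _ (hi x h) (Setoid.symm' _ (hi y hy))
    · rw [if_neg hy, ← part_eq_part_iff] at h
      exact stack_of_part_eq h
  constructor
  · refine stack_le_ker (fun a => joinedPart i j π (Sum.elim id id a)) hd fun x y h => ?_
    change joinedPart i j π x = joinedPart i j π y
    rw [joinedPart, joinedPart, h]
  · intro h
    exact Setoid.trans' _ (hbot a) (Setoid.trans' _ (hcon _ _ h) (Setoid.symm' _ (hbot b)))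

theorem removed_join (π : Finpartition (Finset.univ : Finset (Fin k))) :
    removed (joinDiagram i j) π = 0 :=
  removed_eq_zero fun y => ⟨y, by simp [stack_join_iff]⟩

theorem topRow_join {π : Finpartition (Finset.univ : Finset (Fin k))} {x y : Fin k} :
    topRow (joinDiagram i j) π x y ↔ x ∈ joinedPart i j π y := by
  rw [mem_joinedPart_iff]
  exact stack_join_iff i j π (Sum.inl x) (Sum.inl y)

theorem connectedTop_join (T : SPTBar lam k) {c : ℕ × ℕ} (hc : c ∈ belowFirstRow lam) :
    connectedTop (joinDiagram i j) T.1.content (T.1.entry c) =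
      if T.1.entry c = T.1.content.part i ∨ T.1.entry c = T.1.content.part j then
        T.1.content.part i ∪ T.1.content.part j else T.1.entry c := by
  obtain ⟨y, hy⟩ := (mem_parts_iff _).1 (entry_mem_parts T hc)
  rw [← hy]
  ext x
  rw [mem_connectedTop]
  simp only [stack_join_iff, Sum.elim_inl, Sum.elim_inr, id_eq, ← mem_joinedPart_iff]
  constructor
  · rintro ⟨z, hz, h⟩
    rw [← part_eq_part_iff] at hz
    rwa [joinedPart, hz] at h
  · exact fun h => ⟨y, T.1.content.mem_part (Finset.mem_univ y), h⟩

theorem act_join_same {T : SPTBar lam k} (hij : T.1.content.part i = T.1.content.part j) :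
    act (joinDiagram i j) (natVec T) = natVec T := by
  refine act_eq_of_removed_eq_zero ⟨?_, fun c hc => ?_⟩ (removed_join i j _)
  · ext x y
    rw [Setoid.ker_def, topRow_join, part_eq_part_iff, joinedPart]
    split_ifs with h
    · rw [← hij, or_self] at h
      rw [← hij, Finset.union_self, h]
    · rfl
  · rw [connectedTop_join i j T hc]
    split_ifs with h
    · rw [← hij, or_self] at h
      rw [← hij, Finset.union_self, h]
    · rfl

theorem act_join_propagating {T : SPTBar lam k}
    (hij : T.1.content.part i ≠ T.1.content.part j) (hi : T.1.content.part i ∈ T.1.propagating)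
    (hj : T.1.content.part j ∈ T.1.propagating) : act (joinDiagram i j) (natVec T) = 0 := by
  refine (act_natVec _ T).2 ?_
  rintro ⟨S, hS⟩
  obtain ⟨c, hc, hci⟩ := mem_propagating.1 hi
  obtain ⟨c', hc', hcj⟩ := mem_propagating.1 hj
  have h : S.1.entry c = S.1.entry c' := by
    rw [hS.2 c hc, hS.2 c' hc', connectedTop_join i j T hc, connectedTop_join i j T hc',
      if_pos (Or.inl hci), if_pos (Or.inr hcj)]
  have hcc := congrArg Subtype.val (entry_injective S (a₁ := ⟨c, hc⟩) (a₂ := ⟨c', hc'⟩) h)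
  simp only at hcc
  rw [← hci, ← hcj, hcc] at hij
  exact hij rfl

/-- A block containing both `i` and `j` would be the block of each. Hence the joined block is new
and cannot coincide with an untouched entry of the tableau. -/
theorem union_part_notMem_parts {π : Finpartition (Finset.univ : Finset (Fin k))}
    (hij : π.part i ≠ π.part j) : π.part i ∪ π.part j ∉ π.parts := by
  intro h
  refine hij ((π.part_eq_of_mem h ?_).trans (π.part_eq_of_mem h ?_).symm)
  · exact Finset.mem_union_left _ (π.mem_part (Finset.mem_univ i))
  · exact Finset.mem_union_right _ (π.mem_part (Finset.mem_univ j))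

theorem IsImage.isJoin {T S : SPTBar lam k} (hij : T.1.content.part i ≠ T.1.content.part j)
    (h : IsImage (joinDiagram i j) T S) : IsJoin i j T S := by
  have hbelow := fun c hc => (h.2 c hc).trans (connectedTop_join i j T hc)
  have hpart : ∀ x, S.1.content.part x = joinedPart i j T.1.content x := by
    intro x
    ext y
    rw [h.mem_part, topRow_join]
  have hU := union_part_notMem_parts i j hij
  set B := T.1.content.part i with hB
  set B' := T.1.content.part j with hB'
  have hparts : ∀ X, X ∈ S.1.content.parts ↔
      X = B ∪ B' ∨ (X ∈ T.1.content.parts ∧ X ≠ B ∧ X ≠ B') := by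
    intro X
    rw [mem_parts_iff]
    constructor
    · rintro ⟨x, rfl⟩
      rw [hpart, joinedPart]
      split_ifs with hx
      · exact Or.inl rfl
      · exact Or.inr ⟨T.1.content.part_mem.2 (Finset.mem_univ x), not_or.1 hx⟩
    · rintro (rfl | ⟨hX, hXB⟩)
      · exact ⟨i, by rw [hpart, joinedPart, if_pos (Or.inl rfl)]⟩
      · obtain ⟨x, rfl⟩ := (mem_parts_iff _).1 hX
        exact ⟨x, by rw [hpart, joinedPart, if_neg (not_or.2 hXB)]⟩
  have hprop : ∀ X, X ∈ S.1.propagating ↔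
      (X = B ∪ B' ∧ (B ∈ T.1.propagating ∨ B' ∈ T.1.propagating)) ∨
        (X ∈ T.1.propagating ∧ X ≠ B ∧ X ≠ B') := by
    intro X
    simp only [mem_propagating]
    constructor
    · rintro ⟨c, hc, rfl⟩
      rw [hbelow c hc]
      split_ifs with hx
      · exact Or.inl ⟨rfl, hx.imp (fun h => ⟨c, hc, h⟩) fun h => ⟨c, hc, h⟩⟩
      · exact Or.inr ⟨⟨c, hc, rfl⟩, not_or.1 hx⟩
    · rintro (⟨rfl, ⟨c, hc, hcB⟩ | ⟨c, hc, hcB⟩⟩ | ⟨⟨c, hc, rfl⟩, hx⟩)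
      · exact ⟨c, hc, by rw [hbelow c hc, if_pos (Or.inl hcB)]⟩
      · exact ⟨c, hc, by rw [hbelow c hc, if_pos (Or.inr hcB)]⟩
      · exact ⟨c, hc, by rw [hbelow c hc, if_neg (not_or.2 hx)]⟩
  refine ⟨hbelow, ?_⟩
  ext X
  rw [mem_nonpropagating, hparts, hprop]
  have hUX : X ∈ T.1.content.parts → X ≠ B ∪ B' := fun hX h => hU (h ▸ hX)
  have hUp : X ∈ T.1.propagating → X ∈ T.1.content.parts := mem_parts_of_mem_propagating
  split_ifs with hBp
  · rw [Finset.mem_sdiff, mem_nonpropagating, Finset.mem_insert, Finset.mem_singleton]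
    tauto
  · rw [Finset.mem_insert, Finset.mem_sdiff, mem_nonpropagating, Finset.mem_insert,
      Finset.mem_singleton]
    tauto

theorem exists_join (hk : k ≤ lam.card) {T : SPTBar lam k}
    (hij : T.1.content.part i ≠ T.1.content.part j)
    (hnp : ¬ (T.1.content.part i ∈ T.1.propagating ∧ T.1.content.part j ∈ T.1.propagating)) :
    ∃ S : SPTBar lam k, (∀ S' : SPTBar lam k, IsJoin i j T S' ↔ S' = S) ∧
      act (joinDiagram i j) (natVec T) = natVec S := by
  have hU := union_part_notMem_parts i j hij
  obtain ⟨S, hS⟩ : ∃ S, IsImage (joinDiagram i j) T S := by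
    refine exists_isImage hk (fun c hc => ?_) fun c hc c' hc' heq => ?_
    · rw [connectedTop_join i j T hc]
      split_ifs
      · exact ⟨i, Finset.mem_union_left _ (T.1.content.mem_part (Finset.mem_univ i))⟩
      · exact T.1.content.nonempty_of_mem_parts (entry_mem_parts T hc)
    · dsimp only at heq
      rw [connectedTop_join i j T hc, connectedTop_join i j T hc'] at heq
      have h : T.1.entry c = T.1.entry c' := by
        have hmem : T.1.entry c ∈ T.1.propagating := mem_propagating.2 ⟨c, hc, rfl⟩
        have hmem' : T.1.entry c' ∈ T.1.propagating := mem_propagating.2 ⟨c', hc', rfl⟩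
        -- Two boxes can receive the same image only if both hold `B` or `B'`. They then hold the
        -- same block, because `B` and `B'` are not both propagating; the mixed cases would make the
        -- union an old block.
        split_ifs at heq with h1 h2 h2
        · rcases h1 with h1 | h1 <;> rcases h2 with h2 | h2
          · rw [h1, h2]
          · exact absurd ⟨h1 ▸ hmem, h2 ▸ hmem'⟩ hnp
          · exact absurd ⟨h2 ▸ hmem', h1 ▸ hmem⟩ hnp
          · rw [h1, h2]
        · exact absurd (heq ▸ entry_mem_parts T hc') hU
        · exact absurd (heq ▸ entry_mem_parts T hc) hU
        · exact heq
      exact congrArg Subtype.val (entry_injective T (a₁ := ⟨c, hc⟩) (a₂ := ⟨c', hc'⟩) h)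
  have hjoin := hS.isJoin i j hij
  refine ⟨S, fun S' => ⟨fun h => ?_, fun h => h ▸ hjoin⟩,
    act_eq_of_removed_eq_zero hS (removed_join i j _)⟩
  exact eq_of_entry_eq_of_nonpropagating_eq
    (fun c hc => (h.1 c hc).trans (hjoin.1 c hc).symm) (h.2.trans hjoin.2.symm)

end JoinGenerator

end PartitionAlgebra

/-! ### The theorem -/

open PartitionAlgebra in
theorem mainTheorem8 (k n : ℕ) (hn : 2 * k ≤ n) (lam : YoungDiagram) (hcard : lam.card = n)
    (hlam : (belowFirstRow lam).card ≤ k) :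
    -- the vectors `N_T` with `T` standard form a basis of `P_k^lam`
    (LinearIndependent ℂ (fun T : SSPT lam k => natVec T.1) ∧
      Submodule.span ℂ (Set.range fun T : SSPT lam k => natVec T.1) = ⊤) ∧
    ∀ T : SSPT lam k,
      -- the action of `𝔰ᵢ`
      (∀ (i : ℕ) (hi : i + 1 < k),
        ∃ S : SPTBar lam k,
          (∀ S' : SPTBar lam k, IsSwap ⟨i, by omega⟩ ⟨i + 1, hi⟩ T.1 S' ↔ S' = S) ∧
          act (swapDiagram ⟨i, by omega⟩ ⟨i + 1, hi⟩) (natVec T.1) = natVec S ∧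
          Straightens S) ∧
      -- the action of `𝔭ᵢ`
      (∀ i : Fin k,
        ({i} ∈ T.1.1.nonpropagating →
          act (isolateDiagram i) (natVec T.1) = (n : ℂ) • natVec T.1) ∧
        ({i} ∈ T.1.1.propagating →
          act (isolateDiagram i) (natVec T.1) = 0) ∧
        ({i} ∉ T.1.1.nonpropagating → {i} ∉ T.1.1.propagating →
          ∃ S : SPTBar lam k,
            (∀ S' : SPTBar lam k, IsIsolate i T.1 S' ↔ S' = S) ∧
            act (isolateDiagram i) (natVec T.1) = natVec S ∧
            Straightens S)) ∧
      -- the action of `𝔟ᵢ`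
      (∀ (i : ℕ) (hi : i + 1 < k),
        let B := T.1.1.content.part ⟨i, by omega⟩
        let B' := T.1.1.content.part ⟨i + 1, hi⟩
        (B = B' →
          act (joinDiagram ⟨i, by omega⟩ ⟨i + 1, hi⟩) (natVec T.1) = natVec T.1) ∧
        (B ≠ B' → B ∈ T.1.1.propagating → B' ∈ T.1.1.propagating →
          act (joinDiagram ⟨i, by omega⟩ ⟨i + 1, hi⟩) (natVec T.1) = 0) ∧
        (B ≠ B' → ¬ (B ∈ T.1.1.propagating ∧ B' ∈ T.1.1.propagating) →
          ∃ S : SPTBar lam k,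
            (∀ S' : SPTBar lam k, IsJoin ⟨i, by omega⟩ ⟨i + 1, hi⟩ T.1 S' ↔ S' = S) ∧
            act (joinDiagram ⟨i, by omega⟩ ⟨i + 1, hi⟩) (natVec T.1) = natVec S ∧
            Straightens S)) := by
  subst hcard
  have hk : k ≤ lam.card := by omega
  refine ⟨⟨linearIndependent_natVec, span_natVec hn hlam⟩, fun T => ⟨fun i hi => ?_, fun i => ?_,
    fun i hi => ?_⟩⟩
  · obtain ⟨S, h1, h2⟩ := exists_swap ⟨i, by omega⟩ ⟨i + 1, hi⟩ hk T.1
    exact ⟨S, h1, h2, straightens hn hlam S⟩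
  · refine ⟨act_isolate_nonpropagating i, act_isolate_propagating i, fun h h' => ?_⟩
    obtain ⟨S, h1, h2⟩ := exists_isolate i hk (T := T.1) fun hi => h (mem_nonpropagating.2 ⟨hi, h'⟩)
    exact ⟨S, h1, h2, straightens hn hlam S⟩
  · refine ⟨act_join_same _ _, act_join_propagating _ _, fun hne hnp => ?_⟩
    obtain ⟨S, h1, h2⟩ := exists_join _ _ hk hne hnp
    exact ⟨S, h1, h2, straightens hn hlam S⟩
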